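/- **Virtual strings.** A virtual $n$-string $\beta$ consists of $n$ oriented (core) circles together with a finite set of arrows, an arrow being an ordered pair $(a,b)=(\text{tail},\text{head})$ of points of the circles, such that all endpoints of arrows are distinct. Two virtual $n$-strings are *equal as virtual $n$-strings* if an orientation-preserving homeomorphism between their unions of core circles (which may permute the circles) carries the set of arrows of one onto that of the other. The virtual 1-string induced on the $i$-th core circle of $\beta$ has as arrows the arrows of $\beta$ with both endpoints on that circle. **Virtual homotopy.** Two virtual $n$-strings are virtually homotopic, written $[\beta]=[\beta']$, if, up to equality as above, they are related by a finite sequence of the following moves and their inverses; here $xy$ denotes the arc running from $x$ to $y$ in the positive direction. * Type 1: given an arc $ab$ of a core circle containing no endpoints, add an arrow $(a,b)$ or an arrow $(b,a)$. * Type 2: let $\{a,a'\}$ and $\{b,b'\}$ be the pairs of ends (in either order) of two disjoint arcs of core circles containing no endpoints; add the arrows $(a,b)$ and $(b',a')$. * Type 3a: let $aa^+$, $bb^+$, $cc^+$ be disjoint arcs of core circles with no endpoints in their interiors. If $(a^+,b),(b^+,c),(c^+,a)$ are arrows, replace them with $(a,b^+),(b,c^+),(c,a^+)$. * Type 3b: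 for such arcs, if $(a,b),(a^+,c),(b^+,c^+)$ are arrows, replace them with $(a^+,b^+),(a,c^+),(b,c)$. A virtual string is nontrivial if it is not virtually homotopic to the one without arrows. **The family.** For integers $p_1,q_1,p_2,q_2,r,s\ge 0$ let $\beta(p_1,q_1,p_2,q_2,r,s)$ be the following virtual 2-string on two counterclockwise oriented circles. For $i=1,2$ the $i$-th circle carries $p_i$ parallel arrows from its left (angle $\pi$) to its right (angle $0$) and $q_i$ parallel arrows from its bottom (angle $3\pi/2$) to its top (angle $\pi/2$). In addition there are $r$ parallel arrows from angle $\pi/4$ on the first circle to angle $\pi/4$ on the second, and $s$ parallel arrows from angle $5\pi/4$ on the second circle to angle $5\pi/4$ on the first. Here a set of parallel arrows has its tails in a small arc around the first angle and its heads in a small arc around the second, the heads occurring in the reverse of the cyclic order of the tails; small arcs around different angles of a circle are disjoint. **Proposition.** Let $\beta_1=\beta(p_1,q_1,p_2,q_2,r,s)$ and $\beta_2=\beta(p_1',q_1',p_2',q_2',r',s')$ be two 2-strings of this family such that the virtual 1-strings induced on both core circles of $\beta_1$ and of $\beta_2$ are nontrivial. Then $[\beta_2]=[\beta_1]$ if and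 only if $\beta_2$ and $\beta_1$ are equal as virtual 2-strings. -/

import Mathlib

/-- Points of `n` disjoint copies of the oriented circle `ℝ / ℤ`: the index of the core circle and
the position on it. The circle is oriented by increasing parameter, and its cyclic order
(`btw`, `sbtw`) is the one of Mathlib. -/
abbrev CorePoint (n : ℕ) : Type := Fin n × UnitAddCircle

/-- A virtual `n`-string: `n` oriented circles with finitely many arrows, i.e. ordered pairs
`(tail, head)` of points, all of whose endpoints are distinct. -/
structure VirtualString (n : ℕ) where
  arrows : Set (CorePoint n × CorePoint n)
  finite_arrows : arrows.Finite
  tail_ne_head : ∀ g ∈ arrows, ∀ h ∈ arrows, g.1 ≠ h.2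
  tail_injOn : Set.InjOn Prod.fst arrows
  head_injOn : Set.InjOn Prod.snd arrows

namespace VirtualString

variable {n : ℕ}

/-- The set of all endpoints of arrows. -/
def endpoints (β : VirtualString n) : Set (CorePoint n) :=
  Prod.fst '' β.arrows ∪ Prod.snd '' β.arrows

/-- The virtual `n`-string without arrows. -/
def trivial (n : ℕ) : VirtualString n where
  arrows := ∅
  finite_arrows := Set.finite_empty
  tail_ne_head := by simp
  tail_injOn := by simp
  head_injOn := by simp

/-- The point of the single core circle of a 1-string, seen on the `i`-th of `n` core circles. -/
def onCircle (i : Fin n) (x : CorePoint 1) : CorePoint n := (i, x.2)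

theorem onCircle_injective (i : Fin n) : Function.Injective (onCircle i) := by
  rintro ⟨a, x⟩ ⟨b, y⟩ h
  have h2 : x = y := congrArg Prod.snd h
  exact Prod.ext (Subsingleton.elim _ _) h2

/-- The virtual 1-string induced on the `i`-th core circle: its arrows are the self-arrows of `β`
with both endpoints on that circle. -/
def component (β : VirtualString n) (i : Fin n) : VirtualString 1 where
  arrows := Prod.map (onCircle i) (onCircle i) ⁻¹' β.arrows
  finite_arrows := β.finite_arrows.preimage
    ((onCircle_injective i).prodMap (onCircle_injective i)).injOn
  tail_ne_head := fun _ hg _ hh e =>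
    β.tail_ne_head _ hg _ hh (congrArg (onCircle i) e)
  tail_injOn := fun _ hg _ hh e =>
    (onCircle_injective i).prodMap (onCircle_injective i)
      (β.tail_injOn hg hh (congrArg (onCircle i) e))
  head_injOn := fun _ hg _ hh e =>
    (onCircle_injective i).prodMap (onCircle_injective i)
      (β.head_injOn hg hh (congrArg (onCircle i) e))

/-- Equality as virtual `n`-strings: an orientation preserving homeomorphism of the union of the
core circles (which may permute them) carries the arrows of `β` to the arrows of `β'`. -/
def Same (β β' : VirtualString n) : Prop :=
  ∃ (σ : Equiv.Perm (Fin n)) (f : Fin n → (UnitAddCircle ≃ₜ UnitAddCircle)),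
    (∀ i x y z, sbtw (f i x) (f i y) (f i z) ↔ sbtw x y z) ∧
    β'.arrows =
      Prod.map (fun x : CorePoint n => (σ x.1, f x.1 x.2))
        (fun x : CorePoint n => (σ x.1, f x.1 x.2)) '' β.arrows

/-- The closed arc running from `a` to `b` in the positive direction (used for `a ≠ b` on the same
core circle). -/
def arc (a b : CorePoint n) : Set (CorePoint n) :=
  {x | x.1 = a.1 ∧ btw a.2 x.2 b.2}

/-- The interior of `arc a b`. -/
def openArc (a b : CorePoint n) : Set (CorePoint n) :=
  {x | x.1 = a.1 ∧ sbtw a.2 x.2 b.2}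

/-- The moves generating virtual homotopy. In every constructor the points involved are
automatically distinct, because all endpoints of a virtual string are. -/
inductive Move : VirtualString n → VirtualString n → Prop
  | type1a (β β' : VirtualString n) (a b : CorePoint n)
      (same : a.1 = b.1)
      (free : Disjoint (arc a b) β.endpoints)
      (add_arrow : β'.arrows = insert (a, b) β.arrows) : Move β β'
  | type1b (β β' : VirtualString n) (a b : CorePoint n)
      (same : a.1 = b.1)
      (free : Disjoint (arc a b) β.endpoints)
      (add_arrow : β'.arrows = insert (b, a) β.arrows) : Move β β'
  /-- The arcs run from `u` to `u'` and from `v` to `v'`; the two ends of each arc may be taken in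
  either order when the arrows are attached. -/
  | type2 (β β' : VirtualString n) (a a' b b' u u' v v' : CorePoint n)
      (endsA : (u, u') = (a, a') ∨ (u, u') = (a', a))
      (endsB : (v, v') = (b, b') ∨ (v, v') = (b', b))
      (sameA : u.1 = u'.1) (sameB : v.1 = v'.1)
      (freeA : Disjoint (arc u u') β.endpoints)
      (freeB : Disjoint (arc v v') β.endpoints)
      (disj : Disjoint (arc u u') (arc v v'))
      (add_arrows : β'.arrows = {(a, b), (b', a')} ∪ β.arrows) : Move β β'
  | type3a (β β' : VirtualString n) (a a' b b' c c' : CorePoint n)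
      (sameA : a.1 = a'.1) (sameB : b.1 = b'.1) (sameC : c.1 = c'.1)
      (freeA : Disjoint (openArc a a') β.endpoints)
      (freeB : Disjoint (openArc b b') β.endpoints)
      (freeC : Disjoint (openArc c c') β.endpoints)
      (disjAB : Disjoint (arc a a') (arc b b'))
      (disjBC : Disjoint (arc b b') (arc c c'))
      (disjCA : Disjoint (arc c c') (arc a a'))
      (old : {(a', b), (b', c), (c', a)} ⊆ β.arrows)
      (replace : β'.arrows =
        (β.arrows \ {(a', b), (b', c), (c', a)}) ∪ {(a, b'), (b, c'), (c, a')}) : Move β β'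
  | type3b (β β' : VirtualString n) (a a' b b' c c' : CorePoint n)
      (sameA : a.1 = a'.1) (sameB : b.1 = b'.1) (sameC : c.1 = c'.1)
      (freeA : Disjoint (openArc a a') β.endpoints)
      (freeB : Disjoint (openArc b b') β.endpoints)
      (freeC : Disjoint (openArc c c') β.endpoints)
      (disjAB : Disjoint (arc a a') (arc b b'))
      (disjBC : Disjoint (arc b b') (arc c c'))
      (disjCA : Disjoint (arc c c') (arc a a'))
      (old : {(a, b), (a', c), (b', c')} ⊆ β.arrows)
      (replace : β'.arrows =
        (β.arrows \ {(a, b), (a', c), (b', c')}) ∪ {(a', b'), (a, c'), (b, c)}) : Move β β'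

/-- Virtual homotopy of virtual `n`-strings (with unordered core circles): finite sequences of
moves and their inverses, virtual strings that are equal up to orientation preserving
homeomorphism being identified. -/
def VirtuallyHomotopic : VirtualString n → VirtualString n → Prop :=
  Relation.EqvGen fun β β' => Same β β' ∨ Move β β'

/-- A virtual string is nontrivial if it is not virtually homotopic to the one without arrows. -/
def IsNontrivial (β : VirtualString n) : Prop := ¬ VirtuallyHomotopic β (trivial n)

end VirtualString

/-- The `i`-th of `N` points, in positive cyclic order, placed in the open arc from `k / 8` to
`(k + 1) / 8` of the circle `ℝ / ℤ`. -/
noncomputable def clusterPoint (k : Fin 8) {N : ℕ} (i : Fin N) : UnitAddCircle :=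
  ((((k : ℕ) + ((i : ℕ) + 1) / (N + 1)) / 8 : ℝ) : UnitAddCircle)

theorem clusterPoint_eq {k k' : Fin 8} {N N' : ℕ} {i : Fin N} {i' : Fin N'}
    (h : clusterPoint k i = clusterPoint k' i') :
    k = k' ∧ (((i : ℕ) + 1 : ℝ) / (N + 1) = ((i' : ℕ) + 1) / (N' + 1)) := by
  have bd : ∀ {M : ℕ} (j : Fin M),
      0 < (((j : ℕ) + 1 : ℝ) / (M + 1)) ∧ (((j : ℕ) + 1 : ℝ) / (M + 1)) < 1 := by
    intro M j
    have hj : ((j : ℕ) : ℝ) < M := by exact_mod_cast j.2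
    refine ⟨by positivity, ?_⟩
    rw [div_lt_one (by positivity)]
    linarith
  obtain ⟨h0, h1⟩ := bd i
  obtain ⟨h0', h1'⟩ := bd i'
  have hk : ((k : ℕ) : ℝ) ≤ 7 := by exact_mod_cast Nat.lt_succ_iff.mp k.2
  have hk' : ((k' : ℕ) : ℝ) ≤ 7 := by exact_mod_cast Nat.lt_succ_iff.mp k'.2
  have p0 : (0 : ℝ) ≤ ((k : ℕ) : ℝ) := by positivity
  have p0' : (0 : ℝ) ≤ ((k' : ℕ) : ℝ) := by positivity
  unfold clusterPoint at h
  rw [AddCircle.coe_eq_coe_iff_of_mem_Ico (p := (1 : ℝ)) (a := 0)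
    (by constructor <;> linarith) (by constructor <;> linarith)] at h
  have e : k = k' := by
    apply Fin.ext
    have l1 : ((k : ℕ) : ℝ) < ((k' : ℕ) : ℝ) + 1 := by linarith
    have l2 : ((k' : ℕ) : ℝ) < ((k : ℕ) : ℝ) + 1 := by linarith
    have m1 : (k : ℕ) < (k' : ℕ) + 1 := by exact_mod_cast l1
    have m2 : (k' : ℕ) < (k : ℕ) + 1 := by exact_mod_cast l2
    omega
  subst e
  exact ⟨rfl, by linarith⟩

theorem clusterPoint_inj {k k' : Fin 8} {N : ℕ} {i i' : Fin N} :
    clusterPoint k i = clusterPoint k' i' ↔ k = k' ∧ i = i' := by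
  refine ⟨fun h => ?_, fun h => by rw [h.1, h.2]⟩
  obtain ⟨e, f⟩ := clusterPoint_eq h
  refine ⟨e, Fin.ext ?_⟩
  have hN : (0 : ℝ) < N + 1 := by positivity
  have f' := (div_left_inj' hN.ne').mp f
  have f2 : ((i : ℕ) : ℝ) = (i' : ℕ) := by linarith
  exact_mod_cast f2

theorem clusterPoint_ne {k k' : Fin 8} (hk : k ≠ k') {N N' : ℕ} (i : Fin N) (i' : Fin N') :
    clusterPoint k i ≠ clusterPoint k' i' := fun h => hk (clusterPoint_eq h).1

/-- The index type of the arrows of the 2-string `betaString p₁ q₁ p₂ q₂ r s`. -/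
abbrev BetaIndex (p₁ q₁ p₂ q₂ r s : ℕ) : Type :=
  (Fin p₁ ⊕ Fin q₁) ⊕ (Fin p₂ ⊕ Fin q₂) ⊕ (Fin r ⊕ Fin s)

section

variable {p₁ q₁ p₂ q₂ r s : ℕ}

/-- Tails of the arrows of `betaString`. In each circle, with angle `2 * π * t` at the point `t`,
there are `p` parallel arrows from the left (angle `π`) to the right (angle `0`) and `q` parallel
arrows from the bottom (angle `3 * π / 2`) to the top (angle `π / 2`); `r` parallel arrows run from
angle `π / 4` on the first circle to angle `π / 4` on the second, and `s` parallel arrows from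
angle `5 * π / 4` on the second circle to angle `5 * π / 4` on the first. Parallel arrows do not
cross, so that their heads occur in the reverse of the cyclic order of their tails. -/
noncomputable def betaTail : BetaIndex p₁ q₁ p₂ q₂ r s → CorePoint 2
  | .inl (.inl i) => (0, clusterPoint 4 i)
  | .inl (.inr i) => (0, clusterPoint 6 i)
  | .inr (.inl (.inl i)) => (1, clusterPoint 4 i)
  | .inr (.inl (.inr i)) => (1, clusterPoint 6 i)
  | .inr (.inr (.inl i)) => (0, clusterPoint 1 i)
  | .inr (.inr (.inr i)) => (1, clusterPoint 5 i)

/-- Heads of the arrows of `betaString`; see `betaTail`. -/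
noncomputable def betaHead : BetaIndex p₁ q₁ p₂ q₂ r s → CorePoint 2
  | .inl (.inl i) => (0, clusterPoint 0 i.rev)
  | .inl (.inr i) => (0, clusterPoint 2 i.rev)
  | .inr (.inl (.inl i)) => (1, clusterPoint 0 i.rev)
  | .inr (.inl (.inr i)) => (1, clusterPoint 2 i.rev)
  | .inr (.inr (.inl i)) => (1, clusterPoint 1 i.rev)
  | .inr (.inr (.inr i)) => (0, clusterPoint 5 i.rev)

theorem betaTail_injective :
    Function.Injective (betaTail : BetaIndex p₁ q₁ p₂ q₂ r s → CorePoint 2) := by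
  rintro ((i | i) | (i | i) | (i | i)) ((j | j) | (j | j) | (j | j)) h <;>
    simp [betaTail, clusterPoint_inj, clusterPoint_ne] at h ⊢ <;> exact h

theorem betaHead_injective :
    Function.Injective (betaHead : BetaIndex p₁ q₁ p₂ q₂ r s → CorePoint 2) := by
  rintro ((i | i) | (i | i) | (i | i)) ((j | j) | (j | j) | (j | j)) h <;>
    simp [betaHead, clusterPoint_inj, clusterPoint_ne] at h ⊢ <;> exact h

theorem betaTail_ne_betaHead (x y : BetaIndex p₁ q₁ p₂ q₂ r s) : betaTail x ≠ betaHead y := by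
  rcases x with ((i | i) | (i | i) | (i | i)) <;> rcases y with ((j | j) | (j | j) | (j | j)) <;>
    simp [betaTail, betaHead, clusterPoint_ne]

end

/-- The 2-string `β(p₁, q₁, p₂, q₂, r, s)`. -/
noncomputable def betaString (p₁ q₁ p₂ q₂ r s : ℕ) : VirtualString 2 where
  arrows := Set.range fun x : BetaIndex p₁ q₁ p₂ q₂ r s => (betaTail x, betaHead x)
  finite_arrows := Set.finite_range _
  tail_ne_head := by
    rintro _ ⟨x, rfl⟩ _ ⟨y, rfl⟩
    exact betaTail_ne_betaHead x y
  tail_injOn := by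
    rintro _ ⟨x, rfl⟩ _ ⟨y, rfl⟩ h
    rw [betaTail_injective h]
  head_injOn := by
    rintro _ ⟨x, rfl⟩ _ ⟨y, rfl⟩ h
    rw [betaHead_injective h]

/-! The proof attaches to each core circle homotopy invariants from which the parameters of the
family can be read off. A self-arrow of a circle determines two loops: the arc from its tail to its
head and the complementary arc. A loop is recorded by its doubled indicator function, with value 1
at both ends, so that a loop and its complement add up to exactly twice the indicator of the circle.
The skew form `pairing`, summing `φ(tail) ψ(head) - ψ(tail) φ(head)` over all arrows, is a rescaled
intersection number. The label `(x, t)` of a loop consists of its pairings with its own circle and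
with the whole string; on a circle of index `m` the complementary loop has label `(-x, 2 * m - t)`.

For `k ≠ 0`, `linearInvariant` counts the loops of label `(k, l)`, those along arrows with sign `+`
and complementary ones with sign `-`. `quadraticInvariant` sums, with the product signs, over
ordered pairs of such loops the squares of their intersection numbers; without the square,
skew-symmetry would make the sum vanish. An arrow created by a type 1 move has `x = 0` and is not
seen. The two arrows of a type 2 move have complementary loops, so their contributions cancel. A
type 3 move induces a bijection of arrows preserving all the pairings involved. Hence
`VirtuallyHomotopic.sameInvariants`, up to a permutation of the circles.

On a circle carrying `p` and `q` parallel arrows (`IsCrossing`), the loops with positive first label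
are `p` loops of label `(2 * q, 2 * q + 2 * t)` with sign `+` and `q` loops of label `(2 * p, 2 * p
+ 2 * t)` with sign `-`, where `t` accounts for the arrows joining the circles. For `p ≠ q` the
linear invariant yields `p`, `q`, `t`. For `p = q` it vanishes, and the quadratic invariant, a
negative multiple of a sum of squares, takes over; it is nonzero once `p = q ≥ 2`. The remaining
cases `p = 0`, `q = 0` and `p = q = 1` are excluded because the induced 1-string is then trivial.
Finally `(t, m)` is `(-s, r - s)` on the first circle and `(s, s - r)` on the second. This recovers
`r` and `s` when the circles correspond in order, and forces them all to be zero when the circles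
are exchanged. -/

set_option linter.unusedSimpArgs false

/-! ### Cyclic order -/

section Circular

variable {α : Type*} [CircularOrder α]

/-- The hypotheses place `x` and `y` off the arc from `a` to `a'`, so sliding a point along that arc
meets neither of them. -/
theorem sbtw_congr_middle {x y a a' : α} (hx : sbtw a' x a) (hy : sbtw a' y a) :
    sbtw x a y ↔ sbtw x a' y :=
  ⟨fun h => (h.cyclic_right.trans_right hy.cyclic_left).cyclic_left,
    fun h => hx.cyclic_left.trans_right h⟩

theorem sbtw_congr_left {z b a a' : α} (hz : sbtw a' z a) (hb : sbtw a' b a) :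
    sbtw a z b ↔ sbtw a' z b := by
  rw [sbtw_cyclic, sbtw_congr_middle hb hz, ← sbtw_cyclic]

theorem sbtw_or_sbtw_of_ne {a b c : α} (hab : a ≠ b) (hbc : b ≠ c) (hca : c ≠ a) :
    sbtw a b c ∨ sbtw c b a := by
  by_contra! h
  rw [← btw_iff_not_sbtw, ← btw_iff_not_sbtw] at h
  rcases h.1.antisymm h.2 with e | e | e
  · exact hbc e.symm
  · exact hab e.symm
  · exact hca e.symm

end Circular

/-! ### Weights of points relative to an arc -/

namespace VirtualString

variable {n : ℕ}

theorem left_mem_arc (a b : CorePoint n) : a ∈ arc a b := ⟨rfl, btw_rfl_left⟩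

theorem right_mem_arc {a b : CorePoint n} (h : a.1 = b.1) : b ∈ arc a b := ⟨h.symm, btw_rfl_right⟩

theorem sbtw_of_notMem_arc {a b z : CorePoint n} (hz : z.1 = a.1) (h : z ∉ arc a b) :
    sbtw b.2 z.2 a.2 := by
  rw [sbtw_iff_not_btw]
  exact fun h' => h ⟨hz, h'⟩

open Classical in
/-- The weight of a point with respect to the arc from `a` to `b`: `2` inside the arc, `1` at its
ends, `0` elsewhere. -/
noncomputable def arcWeight (a b z : CorePoint n) : ℤ :=
  if z = a ∨ z = b then 1 else if z ∈ openArc a b then 2 else 0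

/-- The indicator function of the `i`-th core circle. -/
def circleIndicator (i : Fin n) (z : CorePoint n) : ℤ := if z.1 = i then 1 else 0

@[simp] theorem arcWeight_left (a b : CorePoint n) : arcWeight a b a = 1 := by simp [arcWeight]

@[simp] theorem arcWeight_right (a b : CorePoint n) : arcWeight a b b = 1 := by simp [arcWeight]

theorem arcWeight_of_ne {a b z : CorePoint n} (ha : z ≠ a) (hb : z ≠ b)
    [Decidable (z ∈ openArc a b)] :
    arcWeight a b z = if z ∈ openArc a b then 2 else 0 := by
  simp [arcWeight, ha, hb]

theorem arcWeight_of_mem {a b z : CorePoint n} (h : z ∈ openArc a b) : arcWeight a b z = 2 := by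
  have ha : z ≠ a := by rintro rfl; exact sbtw_irrefl_left h.2
  have hb : z ≠ b := by rintro rfl; exact sbtw_irrefl_right h.2
  classical simp [arcWeight_of_ne ha hb, h]

theorem arcWeight_of_notMem {a b z : CorePoint n} (ha : z ≠ a) (hb : z ≠ b)
    (h : z ∉ openArc a b) : arcWeight a b z = 0 := by
  classical simp [arcWeight_of_ne ha hb, h]

theorem arcWeight_of_fst_ne {a b z : CorePoint n} (hab : a.1 = b.1) (h : z.1 ≠ a.1) :
    arcWeight a b z = 0 :=
  arcWeight_of_notMem (by rintro rfl; exact h rfl) (by rintro rfl; exact h hab.symm)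
    (fun h' => h h'.1)

theorem mem_arc_iff_arcWeight_ne_zero {a b z : CorePoint n} (hab : a.1 = b.1) (hne : a ≠ b) :
    z ∈ arc a b ↔ arcWeight a b z ≠ 0 := by
  constructor
  · rintro ⟨h1, h2⟩
    by_cases ha : z = a
    · simp [ha]
    by_cases hb : z = b
    · simp [hb]
    rw [arcWeight_of_mem]
    · simp
    refine ⟨h1, ?_⟩
    rcases sbtw_or_sbtw_of_ne (a := a.2) (b := z.2) (c := b.2)
      (fun e => ha (Prod.ext h1 e.symm)) (fun e => hb (Prod.ext (h1.trans hab) e))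
      (fun e => hne (Prod.ext hab e.symm)) with h | h
    · exact h
    · exact absurd h2 h.not_btw
  · intro h
    by_cases ha : z = a
    · exact ha ▸ left_mem_arc a b
    by_cases hb : z = b
    · subst hb; exact right_mem_arc hab
    by_contra h'
    exact h (arcWeight_of_notMem ha hb fun h'' => h' ⟨h''.1, h''.2.btw⟩)

/-- The two arcs with the same ends cover the circle once, and the half weights at the ends make
this exact at every point. Passing to the complementary loop thus becomes linear algebra in the
pairing. -/
theorem arcWeight_add_swap {a b : CorePoint n} (hab : a.1 = b.1) (hne : a ≠ b) (z : CorePoint n) :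
    arcWeight a b z + arcWeight b a z = 2 * circleIndicator a.1 z := by
  by_cases hz : z.1 = a.1
  · have hi : circleIndicator a.1 z = 1 := by simp [circleIndicator, hz]
    by_cases ha : z = a
    · subst ha; simp [hi]
    by_cases hb : z = b
    · subst hb; simp [hi]
    rcases sbtw_or_sbtw_of_ne (a := a.2) (b := z.2) (c := b.2)
      (fun e => ha (Prod.ext hz e.symm)) (fun e => hb (Prod.ext (hz.trans hab) e))
      (fun e => hne (Prod.ext hab e.symm)) with h | h
    · rw [arcWeight_of_mem ⟨hz, h⟩, arcWeight_of_notMem hb ha (fun h' => h.not_sbtw h'.2), hi]; rfl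
    · rw [arcWeight_of_mem (a := b) ⟨hz.trans hab, h⟩,
        arcWeight_of_notMem ha hb (fun h' => h.not_sbtw h'.2), hi]; rfl
  · rw [arcWeight_of_fst_ne hab hz, arcWeight_of_fst_ne hab.symm (hab ▸ hz)]
    simp [circleIndicator, hz]

theorem arcWeight_swap {a b : CorePoint n} (hab : a.1 = b.1) (hne : a ≠ b) (z : CorePoint n) :
    arcWeight b a z = 2 * circleIndicator a.1 z - arcWeight a b z := by
  rw [← arcWeight_add_swap hab hne]; ring

/-- An arc that contains neither `x` nor `y` lies entirely inside or entirely outside the arc from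
`x` to `y`. -/
theorem arcWeight_congr_point {a a' x y : CorePoint n} (haa : a.1 = a'.1) (hxy : x.1 = y.1)
    (hx : x ∉ arc a a') (hy : y ∉ arc a a') : arcWeight x y a = arcWeight x y a' := by
  have hl := left_mem_arc a a'
  have hr := right_mem_arc haa
  have h1 : a ≠ x := by rintro rfl; exact hx hl
  have h2 : a ≠ y := by rintro rfl; exact hy hl
  have h3 : a' ≠ x := by rintro rfl; exact hx hr
  have h4 : a' ≠ y := by rintro rfl; exact hy hr
  classical
  rw [arcWeight_of_ne h1 h2, arcWeight_of_ne h3 h4]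
  refine if_congr ?_ rfl rfl
  by_cases hc : a.1 = x.1
  · have := sbtw_congr_middle (sbtw_of_notMem_arc hc.symm hx)
      (sbtw_of_notMem_arc (hxy.symm.trans hc.symm) hy)
    simp [openArc, hc, ← haa, this]
  · simp [openArc, hc, ← haa]

theorem arcWeight_congr_left {a a' b z : CorePoint n} (haa : a.1 = a'.1) (hab : a.1 = b.1)
    (hb : b ∉ arc a a') (hz : z ∉ arc a a') : arcWeight a b z = arcWeight a' b z := by
  by_cases hzb : z = b
  · subst hzb; simp
  have h1 : z ≠ a := by rintro rfl; exact hz (left_mem_arc _ _)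
  have h2 : z ≠ a' := by rintro rfl; exact hz (right_mem_arc haa)
  classical
  rw [arcWeight_of_ne h1 hzb, arcWeight_of_ne h2 hzb]
  refine if_congr ?_ rfl rfl
  by_cases hc : z.1 = a.1
  · have := sbtw_congr_left (sbtw_of_notMem_arc hc hz) (sbtw_of_notMem_arc hab.symm hb)
    simp [openArc, hc, ← haa, this]
  · simp [openArc, hc, ← haa]

theorem arcWeight_congr_right {a a' b z : CorePoint n} (haa : a.1 = a'.1) (hab : a.1 = b.1)
    (hb : b ∉ arc a a') (hz : z ∉ arc a a') : arcWeight b a z = arcWeight b a' z := by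
  rw [arcWeight_swap hab (by rintro rfl; exact hb (left_mem_arc _ _)) z,
    arcWeight_swap (haa.symm.trans hab) (by rintro rfl; exact hb (right_mem_arc haa)) z,
    arcWeight_congr_left haa hab hb hz, haa]

/-- This and the next three lemmas say whether a loop traverses a short arc at whose end it starts
or stops: leaving `a` in the positive direction it runs over `a'` first, while leaving `a'` it
misses `a`. -/
theorem arcWeight_left_end {a a' b : CorePoint n} (haa : a.1 = a'.1) (hab : a.1 = b.1)
    (hb : b ∉ arc a a') : arcWeight a b a' = 2 :=
  arcWeight_of_mem ⟨haa.symm, (sbtw_of_notMem_arc hab.symm hb).cyclic_right⟩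

theorem arcWeight_right_start {a a' b : CorePoint n} (hab : a.1 = b.1)
    (hb : b ∉ arc a a') : arcWeight b a' a = 2 :=
  arcWeight_of_mem ⟨hab, (sbtw_of_notMem_arc hab.symm hb).cyclic_left⟩

theorem arcWeight_left_start {a a' b : CorePoint n} (haa : a.1 = a'.1) (hab : a.1 = b.1)
    (hb : b ∉ arc a a') : arcWeight a' b a = 0 := by
  rw [arcWeight_swap (hab.symm.trans haa) (by rintro rfl; exact hb (right_mem_arc haa)),
    arcWeight_right_start hab hb]
  simp [circleIndicator, hab]

theorem arcWeight_right_end {a a' b : CorePoint n} (haa : a.1 = a'.1) (hab : a.1 = b.1)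
    (hb : b ∉ arc a a') : arcWeight b a a' = 0 := by
  rw [arcWeight_swap hab (by rintro rfl; exact hb (left_mem_arc _ _)),
    arcWeight_left_end haa hab hb]
  simp [circleIndicator, haa]

theorem arcWeight_rotate {x y z : CorePoint n} (hxy : x ≠ y) (hyz : y ≠ z) (hzx : z ≠ x)
    (h1 : x.1 = y.1) (h2 : y.1 = z.1) : arcWeight x y z = arcWeight y z x := by
  classical
  rw [arcWeight_of_ne hzx hyz.symm, arcWeight_of_ne hxy hzx.symm]
  refine if_congr ?_ rfl rfl
  simp only [openArc, Set.mem_ofPred_eq, h1, h2, true_and]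
  exact sbtw_cyclic

/-! ### The intersection pairing and the invariants -/

/-- The contribution of an arrow to the intersection pairing of two weight functions. -/
def arrowPairing (φ ψ : CorePoint n → ℤ) (g : CorePoint n × CorePoint n) : ℤ :=
  φ g.1 * ψ g.2 - ψ g.1 * φ g.2

/-- The skew-symmetric intersection pairing of weight functions on the core circles. -/
noncomputable def pairing (β : VirtualString n) (φ ψ : CorePoint n → ℤ) : ℤ :=
  ∑ g ∈ β.finite_arrows.toFinset, arrowPairing φ ψ g

theorem pairing_swap (β : VirtualString n) (φ ψ : CorePoint n → ℤ) :
    pairing β φ ψ = -pairing β ψ φ := by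
  simp only [pairing, arrowPairing, ← Finset.sum_neg_distrib]
  exact Finset.sum_congr rfl fun _ _ => by ring

theorem pairing_self (β : VirtualString n) (φ : CorePoint n → ℤ) : pairing β φ φ = 0 := by
  simp [pairing, arrowPairing]

theorem pairing_two_mul_sub_left (β : VirtualString n) (φ φ' ψ : CorePoint n → ℤ) :
    pairing β (fun z => 2 * φ z - φ' z) ψ = 2 * pairing β φ ψ - pairing β φ' ψ := by
  simp only [pairing, arrowPairing, Finset.mul_sum, ← Finset.sum_sub_distrib]
  exact Finset.sum_congr rfl fun _ _ => by ring

theorem pairing_two_mul_sub_right (β : VirtualString n) (φ φ' ψ : CorePoint n → ℤ) :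
    pairing β ψ (fun z => 2 * φ z - φ' z) = 2 * pairing β ψ φ - pairing β ψ φ' := by
  simp only [pairing, arrowPairing, Finset.mul_sum, ← Finset.sum_sub_distrib]
  exact Finset.sum_congr rfl fun _ _ => by ring

/-- The arrows with both endpoints on the `i`-th core circle. -/
noncomputable def selfArrows (β : VirtualString n) (i : Fin n) :
    Finset (CorePoint n × CorePoint n) :=
  β.finite_arrows.toFinset.filter fun g => g.1.1 = i ∧ g.2.1 = i

theorem mem_selfArrows {β : VirtualString n} {i : Fin n} {g : CorePoint n × CorePoint n} :
    g ∈ selfArrows β i ↔ g ∈ β.arrows ∧ g.1.1 = i ∧ g.2.1 = i := by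
  simp [selfArrows]

/-- The weight function of the arc running from the tail to the head of an arrow. -/
noncomputable def arrowClass (g : CorePoint n × CorePoint n) : CorePoint n → ℤ := arcWeight g.1 g.2

/-- The intersection number of the `i`-th core circle with the whole string. -/
noncomputable def circleIndex (β : VirtualString n) (i : Fin n) : ℤ :=
  pairing β (circleIndicator i) 1

/-- The intersection number of the loop of an arrow with the `i`-th core circle. -/
noncomputable def selfIndex (β : VirtualString n) (i : Fin n) (g : CorePoint n × CorePoint n) : ℤ :=
  pairing β (arrowClass g) (circleIndicator i)

/-- The intersection number of the loop of an arrow with the whole string. -/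
noncomputable def totalIndex (β : VirtualString n) (g : CorePoint n × CorePoint n) : ℤ :=
  pairing β (arrowClass g) 1

/-- The signed count of the two loops at an arrow that have label `(k, l)`, where the loop along
the arrow has label `(x, t)` and the complementary loop has label `(-x, 2 * m - t)`. -/
def linearTerm (m k l x t : ℤ) : ℤ :=
  (if x = k ∧ t = l then 1 else 0) - (if -x = k ∧ 2 * m - t = l then 1 else 0)

/-- The signed count, weighted by the squared intersection number, of the pairs of loops of label
`(k, l)` at two arrows of labels `(x, t)` and `(y, u)` and intersection number `b`. -/
def quadraticTerm (m k l x t y u b : ℤ) : ℤ :=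
  (if x = k ∧ t = l then 1 else 0) * (if y = k ∧ u = l then 1 else 0) * b ^ 2 -
  (if x = k ∧ t = l then 1 else 0) * (if -y = k ∧ 2 * m - u = l then 1 else 0) *
    (2 * x - b) ^ 2 -
  (if -x = k ∧ 2 * m - t = l then 1 else 0) * (if y = k ∧ u = l then 1 else 0) *
    (2 * y + b) ^ 2 +
  (if -x = k ∧ 2 * m - t = l then 1 else 0) * (if -y = k ∧ 2 * m - u = l then 1 else 0) *
    (2 * y - 2 * x + b) ^ 2

/-- Complementation of labels is an involution that exchanges the two oppositely signed summands;
this is the cancellation in a type 2 move. -/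
theorem linearTerm_complement (m k l x t : ℤ) :
    linearTerm m k l x t + linearTerm m k l (-x) (2 * m - t) = 0 := by
  simp only [linearTerm, neg_neg, sub_sub_cancel]
  ring

/-- Both loops at an arrow of self-index `0` have first label `0`. Type 1 moves create such arrows,
which is why only `k ≠ 0` is used. -/
theorem linearTerm_zero {m k l t : ℤ} (hk : k ≠ 0) : linearTerm m k l 0 t = 0 := by
  simp [linearTerm, hk.symm]

/-- Here `2 * x - b` is the pairing of the first loop with the complement of the second. -/
theorem quadraticTerm_complement (m k l x t y u b : ℤ) :
    quadraticTerm m k l x t y u b + quadraticTerm m k l x t (-y) (2 * m - u) (2 * x - b) = 0 := by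
  simp only [quadraticTerm, neg_neg, sub_sub_cancel]
  ring

theorem quadraticTerm_zero {m k l x t u b : ℤ} (hk : k ≠ 0) :
    quadraticTerm m k l x t 0 u b = 0 := by
  simp [quadraticTerm, hk.symm]

theorem quadraticTerm_symm (m k l x t y u b : ℤ) :
    quadraticTerm m k l x t y u b = quadraticTerm m k l y u x t (-b) := by
  simp only [quadraticTerm]
  ring

/-- The value of `quadraticTerm` at two arrows. -/
noncomputable def quadraticWeight (β : VirtualString n) (i : Fin n) (k l : ℤ)
    (g h : CorePoint n × CorePoint n) : ℤ :=
  quadraticTerm (circleIndex β i) k l (selfIndex β i g) (totalIndex β g)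
    (selfIndex β i h) (totalIndex β h) (pairing β (arrowClass g) (arrowClass h))

/-- The signed number of loops of label `(k, l)` at the self-arrows of the `i`-th circle. -/
noncomputable def linearInvariant (β : VirtualString n) (i : Fin n) (k l : ℤ) : ℤ :=
  ∑ g ∈ selfArrows β i, linearTerm (circleIndex β i) k l (selfIndex β i g) (totalIndex β g)

/-- The signed sum, over pairs of loops of label `(k, l)` at the self-arrows of the `i`-th circle,
of the squares of their intersection numbers. -/
noncomputable def quadraticInvariant (β : VirtualString n) (i : Fin n) (k l : ℤ) : ℤ :=
  ∑ g ∈ selfArrows β i, ∑ h ∈ selfArrows β i, quadraticWeight β i k l g h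

/-- Agreement of the invariants of a circle of one string and a circle of another. -/
structure SameInvariants (β : VirtualString n) (i : Fin n) (β' : VirtualString n) (j : Fin n) :
    Prop where
  circleIndex_eq : circleIndex β i = circleIndex β' j
  linear_eq : ∀ k l, k ≠ 0 → linearInvariant β i k l = linearInvariant β' j k l
  quadratic_eq : ∀ k l, k ≠ 0 → quadraticInvariant β i k l = quadraticInvariant β' j k l

theorem SameInvariants.refl (β : VirtualString n) (i : Fin n) : SameInvariants β i β i :=
  ⟨rfl, fun _ _ _ => rfl, fun _ _ _ => rfl⟩

theorem SameInvariants.symm {β β' : VirtualString n} {i j : Fin n}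
    (h : SameInvariants β i β' j) : SameInvariants β' j β i :=
  ⟨h.1.symm, fun k l hk => (h.2 k l hk).symm, fun k l hk => (h.3 k l hk).symm⟩

theorem SameInvariants.trans {β β' β'' : VirtualString n} {i j k : Fin n}
    (h : SameInvariants β i β' j) (h' : SameInvariants β' j β'' k) : SameInvariants β i β'' k :=
  ⟨h.1.trans h'.1, fun a b hk => (h.2 a b hk).trans (h'.2 a b hk),
    fun a b hk => (h.3 a b hk).trans (h'.3 a b hk)⟩

/-! ### Criteria for agreement of the invariants -/

theorem quadraticWeight_symm (β : VirtualString n) (i : Fin n) (k l : ℤ)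
    (g h : CorePoint n × CorePoint n) :
    quadraticWeight β i k l g h = quadraticWeight β i k l h g := by
  rw [quadraticWeight, quadraticTerm_symm, ← pairing_swap, quadraticWeight]

/-- If all arrows are carried along a map of points under which the pairings of arrow classes are
preserved, then so are the invariants. -/
theorem SameInvariants.of_image {β β' : VirtualString n} {i j : Fin n}
    (F : CorePoint n × CorePoint n → CorePoint n × CorePoint n)
    (hF : Set.InjOn F (selfArrows β i))
    (image : ∀ g, g ∈ selfArrows β' j ↔ ∃ h ∈ selfArrows β i, F h = g)
    (hm : circleIndex β' j = circleIndex β i)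
    (hx : ∀ g ∈ selfArrows β i, selfIndex β' j (F g) = selfIndex β i g)
    (ht : ∀ g ∈ selfArrows β i, totalIndex β' (F g) = totalIndex β g)
    (hb : ∀ g ∈ selfArrows β i, ∀ h ∈ selfArrows β i,
      pairing β' (arrowClass (F g)) (arrowClass (F h)) = pairing β (arrowClass g) (arrowClass h)) :
    SameInvariants β i β' j := by
  classical
  have e : selfArrows β' j = (selfArrows β i).image F := by
    ext g; rw [image, Finset.mem_image]
  refine ⟨hm.symm, fun k l _ => ?_, fun k l _ => ?_⟩
  · rw [linearInvariant, linearInvariant, e, Finset.sum_image hF]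
    exact Finset.sum_congr rfl fun g hg => by rw [hm, hx g hg, ht g hg]
  · rw [quadraticInvariant, quadraticInvariant, e, Finset.sum_image hF]
    refine Finset.sum_congr rfl fun g hg => ?_
    rw [Finset.sum_image hF]
    refine Finset.sum_congr rfl fun h hh => ?_
    rw [quadraticWeight, quadraticWeight, hm, hx g hg, ht g hg, hx h hh, ht h hh, hb g hg h hh]

/-- The invariants are unchanged by adding arrows whose contributions cancel. -/
theorem SameInvariants.of_union {β β' : VirtualString n} {i : Fin n}
    (T : Finset (CorePoint n × CorePoint n)) (hT : Disjoint (selfArrows β i) T)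
    (union : ∀ g, g ∈ selfArrows β' i ↔ g ∈ selfArrows β i ∨ g ∈ T)
    (hm : circleIndex β' i = circleIndex β i)
    (hx : ∀ g ∈ selfArrows β i, selfIndex β' i g = selfIndex β i g)
    (ht : ∀ g ∈ selfArrows β i, totalIndex β' g = totalIndex β g)
    (hb : ∀ g ∈ selfArrows β i, ∀ h ∈ selfArrows β i,
      pairing β' (arrowClass g) (arrowClass h) = pairing β (arrowClass g) (arrowClass h))
    (linear_cancel : ∀ k l, k ≠ 0 →
      ∑ g ∈ T, linearTerm (circleIndex β' i) k l (selfIndex β' i g) (totalIndex β' g) = 0)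
    (quadratic_cancel : ∀ k l, k ≠ 0 → ∀ h ∈ selfArrows β' i,
      ∑ g ∈ T, quadraticWeight β' i k l h g = 0) :
    SameInvariants β i β' i := by
  classical
  have e : selfArrows β' i = selfArrows β i ∪ T := by
    ext g; rw [union, Finset.mem_union]
  refine ⟨hm.symm, fun k l hk => ?_, fun k l hk => ?_⟩
  · rw [linearInvariant, linearInvariant, e, Finset.sum_union hT, linear_cancel k l hk, add_zero]
    exact Finset.sum_congr rfl fun g hg => by rw [hm, hx g hg, ht g hg]
  · have inner : quadraticInvariant β' i k l =
        ∑ h ∈ selfArrows β' i, ∑ g ∈ selfArrows β i, quadraticWeight β' i k l h g := by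
      refine Finset.sum_congr rfl fun h hh => ?_
      have := quadratic_cancel k l hk h hh
      rw [e, Finset.sum_union hT, this, add_zero]
    rw [inner, Finset.sum_comm, quadraticInvariant]
    refine Finset.sum_congr rfl fun g hg => ?_
    have hc : ∑ h ∈ T, quadraticWeight β' i k l h g = 0 := by
      rw [← quadratic_cancel k l hk g ((union g).2 (Or.inl hg))]
      exact Finset.sum_congr rfl fun h _ => quadraticWeight_symm _ _ _ _ _ _
    rw [e, Finset.sum_union hT, hc, add_zero]
    refine Finset.sum_congr rfl fun h hh => ?_
    rw [quadraticWeight_symm, quadraticWeight, quadraticWeight, hm, hx g hg, ht g hg, hx h hh,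
      ht h hh, hb h hh g hg]

theorem tail_mem_endpoints {β : VirtualString n} {g : CorePoint n × CorePoint n}
    (h : g ∈ β.arrows) : g.1 ∈ β.endpoints := Or.inl ⟨g, h, rfl⟩

theorem head_mem_endpoints {β : VirtualString n} {g : CorePoint n × CorePoint n}
    (h : g ∈ β.arrows) : g.2 ∈ β.endpoints := Or.inr ⟨g, h, rfl⟩

theorem ne_of_mem_arrows {β : VirtualString n} {g : CorePoint n × CorePoint n}
    (h : g ∈ β.arrows) : g.1 ≠ g.2 := β.tail_ne_head g h g h

/-! ### Invariance under reparametrisation -/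

theorem pairing_image {β β' : VirtualString n} {Φ : CorePoint n → CorePoint n}
    (hΦ : Function.Injective Φ) (h : β'.arrows = Prod.map Φ Φ '' β.arrows)
    (φ ψ : CorePoint n → ℤ) : pairing β' φ ψ = pairing β (φ ∘ Φ) (ψ ∘ Φ) := by
  classical
  have e : β'.finite_arrows.toFinset = β.finite_arrows.toFinset.image (Prod.map Φ Φ) := by
    ext g; simp [h]
  rw [pairing, e, Finset.sum_image (hΦ.prodMap hΦ).injOn]
  rfl

theorem mem_selfArrows_image {β β' : VirtualString n} {Φ : CorePoint n → CorePoint n}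
    {i j : Fin n} (hij : ∀ z, (Φ z).1 = j ↔ z.1 = i)
    (h : β'.arrows = Prod.map Φ Φ '' β.arrows) (g : CorePoint n × CorePoint n) :
    g ∈ selfArrows β' j ↔ ∃ e ∈ selfArrows β i, Prod.map Φ Φ e = g := by
  simp only [mem_selfArrows, h]
  constructor
  · rintro ⟨⟨e, he, rfl⟩, h1, h2⟩
    exact ⟨e, ⟨he, (hij _).1 h1, (hij _).1 h2⟩, rfl⟩
  · rintro ⟨e, ⟨he, h1, h2⟩, rfl⟩
    exact ⟨⟨e, he, rfl⟩, (hij _).2 h1, (hij _).2 h2⟩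

theorem Same.sameInvariants {β β' : VirtualString n} (h : Same β β') :
    ∃ σ : Equiv.Perm (Fin n), ∀ i, SameInvariants β i β' (σ i) := by
  obtain ⟨σ, f, hf, hA⟩ := h
  refine ⟨σ, fun i => ?_⟩
  set Φ : CorePoint n → CorePoint n := fun x => (σ x.1, f x.1 x.2)
  have hΦ : Function.Injective Φ := by
    rintro ⟨i, x⟩ ⟨j, y⟩ e
    obtain ⟨e1, e2⟩ := Prod.ext_iff.1 e
    obtain rfl : i = j := σ.injective e1
    exact Prod.ext rfl ((f i).injective e2)
  have hind : circleIndicator (σ i) ∘ Φ = circleIndicator i := by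
    funext z; simp [circleIndicator, Φ]
  have hone : (1 : CorePoint n → ℤ) ∘ Φ = 1 := rfl
  -- Orientation preserving homeomorphisms carry open arcs to open arcs, so the classes pull back to
  -- classes.
  have hcls : ∀ g ∈ selfArrows β i, arrowClass (Prod.map Φ Φ g) ∘ Φ = arrowClass g := by
    intro g hg
    obtain ⟨-, h1, h2⟩ := mem_selfArrows.1 hg
    funext z
    have : Φ z ∈ openArc (Φ g.1) (Φ g.2) ↔ z ∈ openArc g.1 g.2 := by
      simp only [openArc, Set.mem_ofPred_eq, Φ, σ.injective.eq_iff]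
      refine and_congr_right fun hz => ?_
      rw [hz, h2, h1, hf]
    simp only [Function.comp, arrowClass, arcWeight, Prod.map_fst, Prod.map_snd, hΦ.eq_iff]
    classical exact if_congr Iff.rfl rfl (if_congr this rfl rfl)
  refine SameInvariants.of_image (Prod.map Φ Φ) (hΦ.prodMap hΦ).injOn
    (mem_selfArrows_image (fun z => by simp [Φ]) hA) ?_ ?_ ?_ ?_
  · rw [circleIndex, pairing_image hΦ hA, hind, hone, circleIndex]
  · intro g hg; rw [selfIndex, pairing_image hΦ hA, hind, hcls g hg, selfIndex]
  · intro g hg; rw [totalIndex, pairing_image hΦ hA, hone, hcls g hg, totalIndex]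
  · intro g hg h hh; rw [pairing_image hΦ hA, hcls g hg, hcls h hh]

/-! ### Invariance under moves of types 1 and 2 -/

theorem pairing_union {β β' : VirtualString n} {T : Finset (CorePoint n × CorePoint n)}
    (hT : ∀ g ∈ T, g ∉ β.arrows) (h : ∀ g, g ∈ β'.arrows ↔ g ∈ β.arrows ∨ g ∈ T)
    (φ ψ : CorePoint n → ℤ) :
    pairing β' φ ψ = pairing β φ ψ + ∑ g ∈ T, arrowPairing φ ψ g := by
  classical
  have e : β'.finite_arrows.toFinset = β.finite_arrows.toFinset ∪ T := by
    ext g; simp [h]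
  rw [pairing, e, Finset.sum_union, pairing]
  rw [Finset.disjoint_left]
  intro g hg hg'
  exact hT g hg' (by simpa using hg)

/-- Adding arrows whose contributions to the pairings of the old classes cancel. -/
theorem SameInvariants.of_added {β β' : VirtualString n} {i : Fin n}
    {T : Finset (CorePoint n × CorePoint n)}
    (hT : ∀ g ∈ T, g ∉ β.arrows) (h : ∀ g, g ∈ β'.arrows ↔ g ∈ β.arrows ∨ g ∈ T)
    (P : (CorePoint n → ℤ) → Prop)
    (hP : ∀ φ ψ, P φ → P ψ → ∑ g ∈ T, arrowPairing φ ψ g = 0)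
    (hone : P 1) (hind : P (circleIndicator i))
    (hcls : ∀ g ∈ selfArrows β i, P (arrowClass g))
    (linear_cancel : ∀ k l, k ≠ 0 → ∑ g ∈ T with g.1.1 = i ∧ g.2.1 = i,
      linearTerm (circleIndex β' i) k l (selfIndex β' i g) (totalIndex β' g) = 0)
    (quadratic_cancel : ∀ k l, k ≠ 0 → ∀ h ∈ selfArrows β' i,
      ∑ g ∈ T with g.1.1 = i ∧ g.2.1 = i, quadraticWeight β' i k l h g = 0) :
    SameInvariants β i β' i := by
  have key : ∀ φ ψ, P φ → P ψ → pairing β' φ ψ = pairing β φ ψ := fun φ ψ h1 h2 => by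
    rw [pairing_union hT h, hP φ ψ h1 h2, add_zero]
  refine SameInvariants.of_union (T.filter fun g => g.1.1 = i ∧ g.2.1 = i) ?_ ?_ ?_ ?_ ?_ ?_
    linear_cancel quadratic_cancel
  · rw [Finset.disjoint_left]
    intro g hg hg'
    exact hT g (Finset.mem_filter.1 hg').1 (mem_selfArrows.1 hg).1
  · intro g
    simp only [mem_selfArrows, h, Finset.mem_filter]
    tauto
  · exact key _ _ hind hone
  · exact fun g hg => key _ _ (hcls g hg) hind
  · exact fun g hg => key _ _ (hcls g hg) hone
  · exact fun g hg h hh => key _ _ (hcls g hg) (hcls h hh)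

theorem circleIndicator_congr {a b : CorePoint n} (h : a.1 = b.1) (i : Fin n) :
    circleIndicator i a = circleIndicator i b := by
  simp [circleIndicator, h]

theorem arrowClass_congr_point {β : VirtualString n} {u v : CorePoint n} (huv : u.1 = v.1)
    (free : Disjoint (arc u v) β.endpoints) {i : Fin n} {g : CorePoint n × CorePoint n}
    (hg : g ∈ selfArrows β i) : arrowClass g u = arrowClass g v := by
  obtain ⟨h0, h1, h2⟩ := mem_selfArrows.1 hg
  rw [Set.disjoint_right] at free
  exact arcWeight_congr_point huv (h1.trans h2.symm) (free (tail_mem_endpoints h0))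
    (free (head_mem_endpoints h0))

/-- The arc from `u` to `v` meets no other endpoints, so the loop along it, and therefore its
complement, has zero pairing with the circle. Old classes are equal at `u` and `v`, so the new arrow
contributes nothing to their pairings. -/
theorem SameInvariants.of_isolated_arrow {β β' : VirtualString n} {u v : CorePoint n}
    {g : CorePoint n × CorePoint n} (hg : g = (u, v) ∨ g = (v, u)) (huv : u.1 = v.1)
    (free : Disjoint (arc u v) β.endpoints) (h : β'.arrows = insert g β.arrows) (i : Fin n) :
    SameInvariants β i β' i := by
  have free' := Set.disjoint_right.1 free
  have hgβ : g ∉ β.arrows := by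
    intro hg'
    rcases hg with rfl | rfl
    · exact free' (tail_mem_endpoints hg') (left_mem_arc _ _)
    · exact free' (head_mem_endpoints hg') (left_mem_arc _ _)
  have hT : ∀ e ∈ ({g} : Finset _), e ∉ β.arrows := by simpa using hgβ
  have hu : ∀ e, e ∈ β'.arrows ↔ e ∈ β.arrows ∨ e ∈ ({g} : Finset _) := by
    intro e; simp [h, or_comm]
  have hne : u ≠ v := by
    have := ne_of_mem_arrows (β := β') (g := g) (by simp [h])
    rcases hg with rfl | rfl
    · exact this
    · exact this.symm
  have hindex : g.1.1 = i ∧ g.2.1 = i → selfIndex β' i g = 0 := by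
    intro hi
    have hui : u.1 = i := by rcases hg with rfl | rfl <;> simp_all
    have h0 : pairing β' (arcWeight u v) (circleIndicator i) = 0 := by
      rw [pairing_union hT hu, Finset.sum_singleton]
      have e1 : pairing β (arcWeight u v) (circleIndicator i) = 0 := by
        refine Finset.sum_eq_zero fun e he => ?_
        have he : e ∈ β.arrows := by simpa using he
        have w : ∀ z ∈ β.endpoints, arcWeight u v z = 0 := fun z hz => by
          by_contra hc
          exact free' hz ((mem_arc_iff_arcWeight_ne_zero huv hne).2 hc)
        simp [arrowPairing, w _ (tail_mem_endpoints he), w _ (head_mem_endpoints he)]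
      rw [e1]
      have := circleIndicator_congr huv i
      rcases hg with rfl | rfl <;> simp [arrowPairing, this]
    rcases hg with rfl | rfl
    · exact h0
    · have : arrowClass (v, u) = fun z => 2 * circleIndicator i z - arcWeight u v z := by
        funext z; rw [arrowClass, arcWeight_swap huv hne, hui]
      rw [selfIndex, this, pairing_two_mul_sub_left, pairing_self, h0]; rfl
  refine SameInvariants.of_added hT hu (fun φ => φ u = φ v) ?_ rfl
    (circleIndicator_congr huv i) (fun e he => arrowClass_congr_point huv free he) ?_ ?_
  · intro φ ψ h1 h2
    rcases hg with rfl | rfl <;> simp [arrowPairing, h1, h2, mul_comm]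
  · intro k l hk
    refine Finset.sum_eq_zero fun e he => ?_
    obtain ⟨h1, h2⟩ := Finset.mem_filter.1 he
    rw [Finset.mem_singleton] at h1
    subst h1
    rw [hindex h2, linearTerm_zero hk]
  · intro k l hk f _
    refine Finset.sum_eq_zero fun e he => ?_
    obtain ⟨h1, h2⟩ := Finset.mem_filter.1 he
    rw [Finset.mem_singleton] at h1
    subst h1
    rw [quadraticWeight, hindex h2, quadraticTerm_zero hk]

/-- Of the parallel arcs from `a` to `b` and from `a'` to `b'`, exactly one runs over the starting
point of the other. -/
theorem arcWeight_ends_add {a a' b b' u u' : CorePoint n}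
    (ends : (u, u') = (a, a') ∨ (u, u') = (a', a)) (same : u.1 = u'.1) (hab : a.1 = b.1)
    (hab' : a'.1 = b'.1) (hb : b ∉ arc u u') (hb' : b' ∉ arc u u') :
    arcWeight a b a' + arcWeight a' b' a = 2 := by
  rcases ends with h | h <;> obtain ⟨rfl, rfl⟩ := Prod.ext_iff.1 h <;> dsimp only at *
  · rw [arcWeight_left_end same hab hb, arcWeight_left_start same (same.trans hab') hb']; rfl
  · rw [arcWeight_left_start same (same.trans hab) hb, arcWeight_left_end same hab' hb']; rfl

theorem arcWeight_ends_add' {a a' b b' u u' : CorePoint n}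
    (ends : (u, u') = (a, a') ∨ (u, u') = (a', a)) (same : u.1 = u'.1) (hab : a.1 = b.1)
    (hab' : a'.1 = b'.1) (hb : b ∉ arc u u') (hb' : b' ∉ arc u u') :
    arcWeight b a a' + arcWeight b' a' a = 2 := by
  rcases ends with h | h <;> obtain ⟨rfl, rfl⟩ := Prod.ext_iff.1 h <;> dsimp only at *
  · rw [arcWeight_right_end same hab hb, arcWeight_right_start (same.trans hab') hb']; rfl
  · rw [arcWeight_right_start (same.trans hab) hb, arcWeight_right_end same hab' hb']; rfl

/-- When the new arrows are self-arrows of the circle, the loop along `(b', a')` is, for the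
pairings that matter, the complement of the loop along `(a, b)`. On weights constant along both arcs
the two arrows contribute opposite amounts, so old pairings do not change. -/
theorem SameInvariants.of_complementary_arrows {β β' : VirtualString n}
    {a a' b b' u u' v v' : CorePoint n}
    (endsA : (u, u') = (a, a') ∨ (u, u') = (a', a))
    (endsB : (v, v') = (b, b') ∨ (v, v') = (b', b))
    (sameA : u.1 = u'.1) (sameB : v.1 = v'.1)
    (freeA : Disjoint (arc u u') β.endpoints) (freeB : Disjoint (arc v v') β.endpoints)
    (disj : Disjoint (arc u u') (arc v v'))
    (add_arrows : β'.arrows = {(a, b), (b', a')} ∪ β.arrows) (i : Fin n) :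
    SameInvariants β i β' i := by
  classical
  have freeA' := Set.disjoint_right.1 freeA
  have freeB' := Set.disjoint_right.1 freeB
  have saa : a.1 = a'.1 := by
    rcases endsA with h | h <;> obtain ⟨rfl, rfl⟩ := Prod.ext_iff.1 h
    exacts [sameA, sameA.symm]
  have sbb : b.1 = b'.1 := by
    rcases endsB with h | h <;> obtain ⟨rfl, rfl⟩ := Prod.ext_iff.1 h
    exacts [sameB, sameB.symm]
  have ma : a ∈ arc u u' ∧ a' ∈ arc u u' := by
    rcases endsA with h | h <;> obtain ⟨rfl, rfl⟩ := Prod.ext_iff.1 h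
    exacts [⟨left_mem_arc _ _, right_mem_arc sameA⟩, ⟨right_mem_arc sameA, left_mem_arc _ _⟩]
  have mb : b ∈ arc v v' ∧ b' ∈ arc v v' := by
    rcases endsB with h | h <;> obtain ⟨rfl, rfl⟩ := Prod.ext_iff.1 h
    exacts [⟨left_mem_arc _ _, right_mem_arc sameB⟩, ⟨right_mem_arc sameB, left_mem_arc _ _⟩]
  have na : a ∉ arc v v' := Set.disjoint_left.1 disj ma.1
  have na' : a' ∉ arc v v' := Set.disjoint_left.1 disj ma.2
  have nb : b ∉ arc u u' := Set.disjoint_right.1 disj mb.1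
  have nb' : b' ∉ arc u u' := Set.disjoint_right.1 disj mb.2
  have hne : ((a, b) : CorePoint n × CorePoint n) ≠ (b', a') := by
    intro e
    have e1 : a = b' := (Prod.ext_iff.1 e).1
    exact nb' (e1 ▸ ma.1)
  have hT : ∀ e ∈ ({(a, b), (b', a')} : Finset _), e ∉ β.arrows := by
    intro e he hb
    rw [Finset.mem_insert, Finset.mem_singleton] at he
    rcases he with rfl | rfl
    · exact freeA' (tail_mem_endpoints hb) ma.1
    · exact freeA' (head_mem_endpoints hb) ma.2
  have hu : ∀ e, e ∈ β'.arrows ↔ e ∈ β.arrows ∨ e ∈ ({(a, b), (b', a')} : Finset _) := by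
    intro e; rw [add_arrows]; simp [or_comm]
  have congrA : ∀ {f : CorePoint n → ℤ}, f u = f u' → f a = f a' := by
    intro f hf
    rcases endsA with h | h <;> obtain ⟨rfl, rfl⟩ := Prod.ext_iff.1 h
    exacts [hf, hf.symm]
  have congrB : ∀ {f : CorePoint n → ℤ}, f v = f v' → f b = f b' := by
    intro f hf
    rcases endsB with h | h <;> obtain ⟨rfl, rfl⟩ := Prod.ext_iff.1 h
    exacts [hf, hf.symm]
  have clsA : ∀ g ∈ selfArrows β i, arrowClass g a = arrowClass g a' :=
    fun g hg => congrA (arrowClass_congr_point sameA freeA hg)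
  have clsB : ∀ g ∈ selfArrows β i, arrowClass g b = arrowClass g b' :=
    fun g hg => congrB (arrowClass_congr_point sameB freeB hg)
  have complement : a.1 = i → b.1 = i →
      selfIndex β' i (b', a') = -selfIndex β' i (a, b) ∧
      totalIndex β' (b', a') = 2 * circleIndex β' i - totalIndex β' (a, b) ∧
      ∀ h ∈ selfArrows β' i, pairing β' (arrowClass h) (arrowClass (b', a')) =
        2 * selfIndex β' i h - pairing β' (arrowClass h) (arrowClass (a, b)) := by
    intro hai hbi
    have hab : a.1 = b.1 := hai.trans hbi.symm
    have hab' : a'.1 = b'.1 := saa.symm.trans (hab.trans sbb)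
    have wa := arcWeight_ends_add endsA sameA hab hab' nb nb'
    have wb := arcWeight_ends_add' endsB sameB hab.symm hab'.symm na na'
    have hnab' : a' ≠ b' := by rintro rfl; exact nb' ma.2
    have old : ∀ z ∈ β.endpoints, arcWeight a b z = arcWeight a' b' z := by
      intro z hz
      have e1 : arcWeight a b z = arcWeight a' b z := by
        rcases endsA with h | h <;> obtain ⟨rfl, rfl⟩ := Prod.ext_iff.1 h
        · exact arcWeight_congr_left sameA hab nb (freeA' hz)
        · exact (arcWeight_congr_left sameA (sameA.trans hab) nb (freeA' hz)).symm
      have e2 : arcWeight a' b z = arcWeight a' b' z := by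
        rcases endsB with h | h <;> obtain ⟨rfl, rfl⟩ := Prod.ext_iff.1 h
        · exact arcWeight_congr_right sameB (hab.symm.trans saa) na' (freeB' hz)
        · exact (arcWeight_congr_right sameB hab'.symm na' (freeB' hz)).symm
      rw [e1, e2]
    -- The two classes agree at all old endpoints, so their pairings with `ψ` differ only at the two
    -- new arrows; the hypothesis says that this difference is zero.
    have main : ∀ ψ : CorePoint n → ℤ,
        (1 - arcWeight a' b' a) * (ψ b - ψ b') + (1 - arcWeight a' b' b) * (ψ a' - ψ a) = 0 →
        pairing β' (arcWeight a b) ψ = pairing β' (arcWeight a' b') ψ := by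
      intro ψ hψ
      rw [pairing_union hT hu, pairing_union hT hu, Finset.sum_pair hne, Finset.sum_pair hne]
      have e : pairing β (arcWeight a b) ψ = pairing β (arcWeight a' b') ψ := by
        refine Finset.sum_congr rfl fun g hg => ?_
        have hg : g ∈ β.arrows := by simpa using hg
        rw [arrowPairing, arrowPairing, old _ (tail_mem_endpoints hg),
          old _ (head_mem_endpoints hg)]
      rw [e]
      have wa2 : arcWeight a b a' = 2 - arcWeight a' b' a := by linarith
      have wb2 : arcWeight a b b' = 2 - arcWeight a' b' b := by linarith
      simp only [arrowPairing, arcWeight_left, arcWeight_right, wa2, wb2]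
      linear_combination hψ
    have const : ∀ ψ : CorePoint n → ℤ, ψ a = ψ a' → ψ b = ψ b' →
        pairing β' (arcWeight a b) ψ = pairing β' (arcWeight a' b') ψ := by
      intro ψ h1 h2
      refine main ψ ?_
      rw [h1, h2]; ring
    have rev : arrowClass (b', a') = fun z => 2 * circleIndicator i z - arcWeight a' b' z := by
      funext z; rw [arrowClass, arcWeight_swap hab' hnab', ← saa, hai]
    have cind := const (circleIndicator i) (circleIndicator_congr saa i)
      (circleIndicator_congr sbb i)
    have cone := const 1 rfl rfl
    refine ⟨?_, ?_, fun h hh => ?_⟩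
    · rw [selfIndex, rev, pairing_two_mul_sub_left, pairing_self, ← cind, selfIndex]
      simp [arrowClass]
    · rw [totalIndex, rev, pairing_two_mul_sub_left, ← cone, totalIndex, circleIndex]
      simp [arrowClass]
    -- Old classes are constant on the two arcs. The two new ones are not, and need the explicit
    -- weights at the ends.
    · have hsw : pairing β' (arcWeight a b) (arrowClass h) =
          pairing β' (arcWeight a' b') (arrowClass h) := by
        obtain ⟨h0, h1, h2⟩ := mem_selfArrows.1 hh
        rcases (hu h).1 h0 with h0 | h0
        · have hβ : h ∈ selfArrows β i := mem_selfArrows.2 ⟨h0, h1, h2⟩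
          exact const _ (clsA h hβ) (clsB h hβ)
        · rw [Finset.mem_insert, Finset.mem_singleton] at h0
          rcases h0 with rfl | rfl
          · refine main _ ?_
            simp only [arrowClass, arcWeight_left, arcWeight_right]
            linear_combination (1 - arcWeight a' b' b) * wa - (1 - arcWeight a' b' a) * wb
          · refine main _ ?_
            rw [rev]
            simp only [arcWeight_left, arcWeight_right, circleIndicator_congr saa,
              circleIndicator_congr sbb]
            ring
      rw [rev, pairing_two_mul_sub_right, pairing_swap β' _ (arcWeight a' b'), ← hsw,
        pairing_swap β' _ (arrowClass (a, b)), selfIndex]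
      simp only [arrowClass]
  -- The new arrows are parallel, so either both or neither are self-arrows of the circle.
  have hfilter : a.1 = i ∧ b.1 = i ∧
      ({(a, b), (b', a')} : Finset (CorePoint n × CorePoint n)).filter
        (fun g => g.1.1 = i ∧ g.2.1 = i) = {(a, b), (b', a')} ∨
      ({(a, b), (b', a')} : Finset (CorePoint n × CorePoint n)).filter
        (fun g => g.1.1 = i ∧ g.2.1 = i) = ∅ := by
    by_cases hi : a.1 = i ∧ b.1 = i
    · left
      refine ⟨hi.1, hi.2, Finset.filter_true_of_mem ?_⟩
      simp [hi.1, hi.2, ← saa, ← sbb]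
    · right
      refine Finset.filter_false_of_mem ?_
      simp [← saa, ← sbb]
      tauto
  refine SameInvariants.of_added hT hu (fun φ => φ a = φ a' ∧ φ b = φ b') ?_ ⟨rfl, rfl⟩
    ⟨circleIndicator_congr saa i, circleIndicator_congr sbb i⟩
    (fun e he => ⟨clsA e he, clsB e he⟩) ?_ ?_
  · rintro φ ψ ⟨h1, h2⟩ ⟨h3, h4⟩
    rw [Finset.sum_pair hne]
    simp only [arrowPairing, h1, h2, h3, h4]
    ring
  · intro k l hk
    rcases hfilter with ⟨hai, hbi, e⟩ | e
    · obtain ⟨c1, c2, -⟩ := complement hai hbi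
      rw [e, Finset.sum_pair hne, c1, c2, linearTerm_complement]
    · rw [e, Finset.sum_empty]
  · intro k l hk h hh
    rcases hfilter with ⟨hai, hbi, e⟩ | e
    · obtain ⟨c1, c2, c3⟩ := complement hai hbi
      rw [e, Finset.sum_pair hne, quadraticWeight, quadraticWeight, c1, c2, c3 h hh,
        quadraticTerm_complement]
    · rw [e, Finset.sum_empty]

/-! ### Invariance under moves of type 3 -/

/-- The permutation of the points exchanging the ends of three arcs. -/
noncomputable def triangleSwap (a a' b b' c c' : CorePoint n) : Equiv.Perm (CorePoint n) :=
  (Equiv.swap a a' * (Equiv.swap b b' * Equiv.swap c c') : Equiv.Perm (CorePoint n))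

/-- Three pairwise disjoint arcs with distinct ends. -/
structure IsTriangle (a a' b b' c c' : CorePoint n) : Prop where
  sameA : a.1 = a'.1
  sameB : b.1 = b'.1
  sameC : c.1 = c'.1
  neA : a ≠ a'
  neB : b ≠ b'
  neC : c ≠ c'
  disjAB : Disjoint (arc a a') (arc b b')
  disjBC : Disjoint (arc b b') (arc c c')
  disjCA : Disjoint (arc c c') (arc a a')

theorem ne_of_disjoint_arc {a a' b b' x y : CorePoint n} (hd : Disjoint (arc a a') (arc b b'))
    (hx : x ∈ arc a a') (hy : y ∈ arc b b') : x ≠ y := by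
  rintro rfl; exact Set.disjoint_left.1 hd hx hy

namespace IsTriangle

variable {a a' b b' c c' : CorePoint n}

theorem rotate (h : IsTriangle a a' b b' c c') : IsTriangle b b' c c' a a' :=
  ⟨h.sameB, h.sameC, h.sameA, h.neB, h.neC, h.neA, h.disjBC, h.disjCA, h.disjAB⟩

theorem flip (h : IsTriangle a a' b b' c c') : IsTriangle b b' a a' c c' :=
  ⟨h.sameB, h.sameA, h.sameC, h.neB, h.neA, h.neC, h.disjAB.symm, h.disjCA.symm, h.disjBC.symm⟩

theorem ne_AB (h : IsTriangle a a' b b' c c') : a ≠ b ∧ a ≠ b' ∧ a' ≠ b ∧ a' ≠ b' :=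
  ⟨ne_of_disjoint_arc h.disjAB (left_mem_arc _ _) (left_mem_arc _ _),
    ne_of_disjoint_arc h.disjAB (left_mem_arc _ _) (right_mem_arc h.sameB),
    ne_of_disjoint_arc h.disjAB (right_mem_arc h.sameA) (left_mem_arc _ _),
    ne_of_disjoint_arc h.disjAB (right_mem_arc h.sameA) (right_mem_arc h.sameB)⟩

theorem triangleSwap_apply (h : IsTriangle a a' b b' c c') :
    triangleSwap a a' b b' c c' a = a' ∧ triangleSwap a a' b b' c c' a' = a ∧
    triangleSwap a a' b b' c c' b = b' ∧ triangleSwap a a' b b' c c' b' = b ∧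
    triangleSwap a a' b b' c c' c = c' ∧ triangleSwap a a' b b' c c' c' = c := by
  obtain ⟨x1, x2, x3, x4⟩ := h.ne_AB
  obtain ⟨y1, y2, y3, y4⟩ := h.rotate.ne_AB
  obtain ⟨z1, z2, z3, z4⟩ := h.rotate.rotate.ne_AB
  have := h.neA
  have := h.neB
  have := h.neC
  simp only [triangleSwap, Equiv.Perm.mul_apply]
  refine ⟨?_, ?_, ?_, ?_, ?_, ?_⟩ <;> 
    simp [Equiv.swap_apply_def, *, x1.symm, x2.symm, x3.symm, x4.symm, y1.symm, y2.symm, y3.symm,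
      y4.symm, z1.symm, z2.symm, z3.symm, z4.symm]

theorem triangleSwap_apply_of_ne {z : CorePoint n} (h1 : z ≠ a) (h2 : z ≠ a') (h3 : z ≠ b)
    (h4 : z ≠ b') (h5 : z ≠ c) (h6 : z ≠ c') : triangleSwap a a' b b' c c' z = z := by
  simp [triangleSwap, Equiv.swap_apply_of_ne_of_ne, *]

/-- The weights of the arcs joining the first two sides, at the ends of these sides. -/
theorem arcWeight_pair (h : IsTriangle a a' b b' c c') (hab : a.1 = b.1) :
    arcWeight a b a' = 2 ∧ arcWeight a b' a' = 2 ∧ arcWeight a' b a = 0 ∧ arcWeight a' b' a = 0 ∧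
    arcWeight a b b' = 0 ∧ arcWeight a' b b' = 0 ∧ arcWeight a b' b = 2 ∧
    arcWeight a' b' b = 2 := by
  have hb : b ∉ arc a a' := Set.disjoint_right.1 h.disjAB (left_mem_arc _ _)
  have hb' : b' ∉ arc a a' := Set.disjoint_right.1 h.disjAB (right_mem_arc h.sameB)
  have ha : a ∉ arc b b' := Set.disjoint_left.1 h.disjAB (left_mem_arc _ _)
  have hna : a' ∉ arc b b' := Set.disjoint_left.1 h.disjAB (right_mem_arc h.sameA)
  have hab' : a.1 = b'.1 := hab.trans h.sameB
  have hba' : b.1 = a'.1 := hab.symm.trans h.sameA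
  exact ⟨arcWeight_left_end h.sameA hab hb, arcWeight_left_end h.sameA hab' hb',
    arcWeight_left_start h.sameA hab hb, arcWeight_left_start h.sameA hab' hb',
    arcWeight_right_end h.sameB hab.symm ha, arcWeight_right_end h.sameB hba' hna,
    arcWeight_right_start hab.symm ha, arcWeight_right_start (hab.symm.trans h.sameA) hna⟩

/-- The weights of the arcs joining the first two sides, off these sides. -/
theorem arcWeight_congr (h : IsTriangle a a' b b' c c') (hab : a.1 = b.1) {z : CorePoint n}
    (hzA : z ∉ arc a a') (hzB : z ∉ arc b b') :
    arcWeight a' b z = arcWeight a b z ∧ arcWeight a b' z = arcWeight a b z ∧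
    arcWeight a' b' z = arcWeight a b z := by
  have hb : b ∉ arc a a' := Set.disjoint_right.1 h.disjAB (left_mem_arc _ _)
  have ha : a ∉ arc b b' := Set.disjoint_left.1 h.disjAB (left_mem_arc _ _)
  have ha' : a' ∉ arc b b' := Set.disjoint_left.1 h.disjAB (right_mem_arc h.sameA)
  have e1 := arcWeight_congr_left h.sameA hab hb hzA
  have e2 := arcWeight_congr_right h.sameB hab.symm ha hzB
  have e3 := arcWeight_congr_right h.sameB (hab.symm.trans h.sameA) ha' hzB
  exact ⟨e1.symm, e2.symm, by rw [← e3, e1]⟩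

/-- The weights of the arcs joining the first two sides, on the third side. -/
theorem arcWeight_third (h : IsTriangle a a' b b' c c') (hab : a.1 = b.1) :
    arcWeight a' b c = arcWeight a b c ∧ arcWeight a b' c = arcWeight a b c ∧
    arcWeight a' b' c = arcWeight a b c ∧ arcWeight a b c' = arcWeight a b c ∧
    arcWeight a' b c' = arcWeight a b c ∧ arcWeight a b' c' = arcWeight a b c ∧
    arcWeight a' b' c' = arcWeight a b c := by
  have ha : a ∉ arc c c' := Set.disjoint_right.1 h.disjCA (left_mem_arc _ _)
  have hb : b ∉ arc c c' := Set.disjoint_left.1 h.disjBC (left_mem_arc _ _)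
  obtain ⟨e1, e2, e3⟩ := h.arcWeight_congr hab (z := c)
    (Set.disjoint_left.1 h.disjCA (left_mem_arc _ _))
    (Set.disjoint_right.1 h.disjBC (left_mem_arc _ _))
  obtain ⟨f1, f2, f3⟩ := h.arcWeight_congr hab (z := c')
    (Set.disjoint_left.1 h.disjCA (right_mem_arc h.sameC))
    (Set.disjoint_right.1 h.disjBC (right_mem_arc h.sameC))
  have e := arcWeight_congr_point h.sameC hab ha hb
  exact ⟨e1, e2, e3, e.symm, f1.trans e.symm, f2.trans e.symm, f3.trans e.symm⟩

theorem arcWeight_rotate (h : IsTriangle a a' b b' c c') (hab : a.1 = b.1) (hbc : b.1 = c.1) :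
    arcWeight b c a = arcWeight a b c :=
  (VirtualString.arcWeight_rotate h.ne_AB.1 h.rotate.ne_AB.1 h.rotate.rotate.ne_AB.1 hab hbc).symm

/-- With `arcWeight_rotate`, this expresses all weights among the three sides through the single
number `arcWeight a b c`, which encodes their cyclic order. The local identities can then be checked
for both orders at once. -/
theorem arcWeight_flip (h : IsTriangle a a' b b' c c') (hab : a.1 = b.1) (hbc : b.1 = c.1) :
    arcWeight a c b = 2 - arcWeight a b c := by
  rw [← h.arcWeight_rotate hab hbc, ← h.rotate.arcWeight_rotate hbc (hbc.symm.trans hab.symm),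
    arcWeight_swap (hab.trans hbc).symm h.rotate.rotate.ne_AB.1]
  simp [circleIndicator, hbc]

end IsTriangle

theorem pairing_eq_of_local {β : VirtualString n} {g₁ g₂ g₃ : CorePoint n × CorePoint n}
    (h₁ : g₁ ∈ β.arrows) (h₂ : g₂ ∈ β.arrows) (h₃ : g₃ ∈ β.arrows)
    (h₁₂ : g₁ ≠ g₂) (h₁₃ : g₁ ≠ g₃) (h₂₃ : g₂ ≠ g₃) {φ φ' ψ ψ' : CorePoint n → ℤ}
    (hφ : ∀ g ∈ β.arrows, g ≠ g₁ → g ≠ g₂ → g ≠ g₃ → φ g.1 = φ' g.1 ∧ φ g.2 = φ' g.2)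
    (hψ : ∀ g ∈ β.arrows, g ≠ g₁ → g ≠ g₂ → g ≠ g₃ → ψ g.1 = ψ' g.1 ∧ ψ g.2 = ψ' g.2)
    (loc : arrowPairing φ ψ g₁ + arrowPairing φ ψ g₂ + arrowPairing φ ψ g₃ =
      arrowPairing φ' ψ' g₁ + arrowPairing φ' ψ' g₂ + arrowPairing φ' ψ' g₃) :
    pairing β φ ψ = pairing β φ' ψ' := by
  classical
  have hs : ({g₁, g₂, g₃} : Finset _) ⊆ β.finite_arrows.toFinset := by
    intro g hg
    simp only [Finset.mem_insert, Finset.mem_singleton] at hg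
    rcases hg with rfl | rfl | rfl <;> simpa
  have split : ∀ f : CorePoint n × CorePoint n → ℤ, ∑ g ∈ β.finite_arrows.toFinset, f g =
      ∑ g ∈ β.finite_arrows.toFinset \ {g₁, g₂, g₃}, f g + (f g₁ + f g₂ + f g₃) := by
    intro f
    rw [← Finset.sum_sdiff hs, Finset.sum_insert (by simp [h₁₂, h₁₃]), Finset.sum_pair h₂₃]
    ring
  rw [pairing, pairing, split, split, loc]
  congr 1
  refine Finset.sum_congr rfl fun g hg => ?_
  simp only [Finset.mem_sdiff, Set.Finite.mem_toFinset, Finset.mem_insert, Finset.mem_singleton,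
    not_or] at hg
  obtain ⟨hg, e1, e2, e3⟩ := hg
  obtain ⟨f1, f2⟩ := hφ g hg e1 e2 e3
  obtain ⟨f3, f4⟩ := hψ g hg e1 e2 e3
  rw [arrowPairing, arrowPairing, f1, f2, f3, f4]

theorem notMem_arc_of_free {β : VirtualString n} {a a' z : CorePoint n} (same : a.1 = a'.1)
    (hne : a ≠ a') (free : Disjoint (openArc a a') β.endpoints) (hz : z ∈ β.endpoints)
    (ha : z ≠ a) (ha' : z ≠ a') : z ∉ arc a a' := by
  rw [mem_arc_iff_arcWeight_ne_zero same hne, not_not]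
  exact arcWeight_of_notMem ha ha' (Set.disjoint_right.1 free hz)

/-- Exchanging the ends of three arcs whose ends are the endpoints of three arrows preserves the
invariants, provided that it preserves the local contributions to the pairings. -/
theorem SameInvariants.of_triangle {β β' : VirtualString n} {a a' b b' c c' : CorePoint n}
    {g₁ g₂ g₃ : CorePoint n × CorePoint n} (tri : IsTriangle a a' b b' c c')
    (freeA : Disjoint (openArc a a') β.endpoints) (freeB : Disjoint (openArc b b') β.endpoints)
    (freeC : Disjoint (openArc c c') β.endpoints)
    (h₁ : g₁ ∈ β.arrows) (h₂ : g₂ ∈ β.arrows) (h₃ : g₃ ∈ β.arrows)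
    (h₁₂ : g₁ ≠ g₂) (h₁₃ : g₁ ≠ g₃) (h₂₃ : g₂ ≠ g₃)
    (ends : ∀ z, (z = a ∨ z = a' ∨ z = b ∨ z = b' ∨ z = c ∨ z = c') →
      ∃ g, (g = g₁ ∨ g = g₂ ∨ g = g₃) ∧ (z = g.1 ∨ z = g.2))
    (τ : Equiv.Perm (CorePoint n)) (hτ : τ = triangleSwap a a' b b' c c')
    (replace : β'.arrows = (β.arrows \ {g₁, g₂, g₃}) ∪
      {Prod.map τ τ g₁, Prod.map τ τ g₂, Prod.map τ τ g₃})
    (i : Fin n)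
    (off : ∀ g, (g = g₁ ∨ g = g₂ ∨ g = g₃) → g.1.1 = i → g.2.1 = i → ∀ z, z ∉ arc a a' →
      z ∉ arc b b' → z ∉ arc c c' → arrowClass (Prod.map τ τ g) z = arrowClass g z)
    (local_one : ∀ g, (g = g₁ ∨ g = g₂ ∨ g = g₃) → g.1.1 = i → g.2.1 = i →
      ∀ φ ψ : CorePoint n → ℤ, φ = arrowClass (Prod.map τ τ g) ∘ τ →
        ψ a = ψ a' → ψ b = ψ b' → ψ c = ψ c' →
        arrowPairing φ ψ g₁ + arrowPairing φ ψ g₂ + arrowPairing φ ψ g₃ =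
        arrowPairing (arrowClass g) ψ g₁ + arrowPairing (arrowClass g) ψ g₂ +
          arrowPairing (arrowClass g) ψ g₃)
    (local_two : ∀ g, (g = g₁ ∨ g = g₂ ∨ g = g₃) → g.1.1 = i → g.2.1 = i →
      ∀ h, (h = g₁ ∨ h = g₂ ∨ h = g₃) → h.1.1 = i → h.2.1 = i →
      ∀ φ ψ : CorePoint n → ℤ, φ = arrowClass (Prod.map τ τ g) ∘ τ →
        ψ = arrowClass (Prod.map τ τ h) ∘ τ →
        arrowPairing φ ψ g₁ + arrowPairing φ ψ g₂ + arrowPairing φ ψ g₃ =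
        arrowPairing (arrowClass g) (arrowClass h) g₁ +
          arrowPairing (arrowClass g) (arrowClass h) g₂ +
          arrowPairing (arrowClass g) (arrowClass h) g₃) :
    SameInvariants β i β' i := by
  obtain ⟨ta, ta', tb, tb', tc, tc'⟩ := tri.triangleSwap_apply
  rw [← hτ] at ta ta' tb tb' tc tc'
  have fix : ∀ z, ¬(z = a ∨ z = a' ∨ z = b ∨ z = b' ∨ z = c ∨ z = c') → τ z = z := by
    intro z hz
    simp only [not_or] at hz
    obtain ⟨k1, k2, k3, k4, k5, k6⟩ := hz
    rw [hτ]
    exact IsTriangle.triangleSwap_apply_of_ne k1 k2 k3 k4 k5 k6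
  have invariant_comp : ∀ φ : CorePoint n → ℤ, φ a = φ a' → φ b = φ b' → φ c = φ c' →
      φ ∘ τ = φ := by
    intro φ e1 e2 e3
    funext z
    by_cases hz : z = a ∨ z = a' ∨ z = b ∨ z = b' ∨ z = c ∨ z = c'
    · rcases hz with rfl | rfl | rfl | rfl | rfl | rfl <;>
        simp [ta, ta', tb, tb', tc, tc', e1, e2, e3]
    · simp [fix z hz]
  have tri_arrow : ∀ g, (g = g₁ ∨ g = g₂ ∨ g = g₃) → g ∈ β.arrows := by
    rintro g (rfl | rfl | rfl) <;> assumption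
  have ends_ne : ∀ g ∈ β.arrows, ¬(g = g₁ ∨ g = g₂ ∨ g = g₃) →
      ¬(g.1 = a ∨ g.1 = a' ∨ g.1 = b ∨ g.1 = b' ∨ g.1 = c ∨ g.1 = c') ∧
      ¬(g.2 = a ∨ g.2 = a' ∨ g.2 = b ∨ g.2 = b' ∨ g.2 = c ∨ g.2 = c') := by
    intro g hg hgT
    constructor
    · intro hz
      obtain ⟨h, hT, e | e⟩ := ends _ hz
      · exact hgT (β.tail_injOn hg (tri_arrow h hT) e ▸ hT)
      · exact β.tail_ne_head g hg h (tri_arrow h hT) e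
    · intro hz
      obtain ⟨h, hT, e | e⟩ := ends _ hz
      · exact β.tail_ne_head h (tri_arrow h hT) g hg e.symm
      · exact hgT (β.head_injOn hg (tri_arrow h hT) e ▸ hT)
  have notMem : ∀ z ∈ β.endpoints, ¬(z = a ∨ z = a' ∨ z = b ∨ z = b' ∨ z = c ∨ z = c') →
      z ∉ arc a a' ∧ z ∉ arc b b' ∧ z ∉ arc c c' := by
    intro z hz hne
    simp only [not_or] at hne
    obtain ⟨k1, k2, k3, k4, k5, k6⟩ := hne
    exact ⟨notMem_arc_of_free tri.sameA tri.neA freeA hz k1 k2,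
      notMem_arc_of_free tri.sameB tri.neB freeB hz k3 k4,
      notMem_arc_of_free tri.sameC tri.neC freeC hz k5 k6⟩
  -- `τ` moves only the six ends, all of which belong to the three arrows; every other arrow is
  -- fixed.
  have image : β'.arrows = Prod.map τ τ '' β.arrows := by
    have hfix : ∀ g ∈ β.arrows, ¬(g = g₁ ∨ g = g₂ ∨ g = g₃) → Prod.map τ τ g = g := by
      intro g hg hgT
      obtain ⟨k1, k2⟩ := ends_ne g hg hgT
      exact Prod.ext (fix _ k1) (fix _ k2)
    rw [replace]
    ext g
    constructor
    · rintro (⟨hg, hgT⟩ | hg)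
      · exact ⟨g, hg, hfix g hg (by simpa using hgT)⟩
      · rcases hg with rfl | rfl | rfl
        exacts [⟨g₁, h₁, rfl⟩, ⟨g₂, h₂, rfl⟩, ⟨g₃, h₃, rfl⟩]
    · rintro ⟨h, hh, rfl⟩
      by_cases hT : h = g₁ ∨ h = g₂ ∨ h = g₃
      · right
        rcases hT with rfl | rfl | rfl <;> simp
      · left
        rw [hfix h hh hT]
        exact ⟨hh, by simpa using hT⟩
  -- The class of any other self-arrow is constant on each side, hence invariant under `τ`.
  have generic : ∀ g ∈ selfArrows β i, ¬(g = g₁ ∨ g = g₂ ∨ g = g₃) →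
      Prod.map τ τ g = g ∧ arrowClass g a = arrowClass g a' ∧ arrowClass g b = arrowClass g b' ∧
        arrowClass g c = arrowClass g c' := by
    intro g hg hgT
    obtain ⟨hg, k1, k2⟩ := mem_selfArrows.1 hg
    obtain ⟨e1, e2⟩ := ends_ne g hg hgT
    obtain ⟨p1, p2, p3⟩ := notMem _ (tail_mem_endpoints hg) e1
    obtain ⟨q1, q2, q3⟩ := notMem _ (head_mem_endpoints hg) e2
    have k := k1.trans k2.symm
    exact ⟨Prod.ext (fix _ e1) (fix _ e2), arcWeight_congr_point tri.sameA k p1 q1,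
      arcWeight_congr_point tri.sameB k p2 q2, arcWeight_congr_point tri.sameC k p3 q3⟩
  have offT : ∀ g ∈ selfArrows β i, ∀ e ∈ β.arrows, e ≠ g₁ → e ≠ g₂ → e ≠ g₃ →
      (arrowClass (Prod.map τ τ g) ∘ τ) e.1 = arrowClass g e.1 ∧
      (arrowClass (Prod.map τ τ g) ∘ τ) e.2 = arrowClass g e.2 := by
    intro g hg e he e1 e2 e3
    obtain ⟨f1, f2⟩ := ends_ne e he (by tauto)
    simp only [Function.comp, fix _ f1, fix _ f2]
    by_cases hT : g = g₁ ∨ g = g₂ ∨ g = g₃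
    · obtain ⟨-, k1, k2⟩ := mem_selfArrows.1 hg
      obtain ⟨p1, p2, p3⟩ := notMem _ (tail_mem_endpoints he) f1
      obtain ⟨q1, q2, q3⟩ := notMem _ (head_mem_endpoints he) f2
      exact ⟨off g hT k1 k2 _ p1 p2 p3, off g hT k1 k2 _ q1 q2 q3⟩
    · rw [(generic g hg hT).1]
      exact ⟨rfl, rfl⟩
  have one : ∀ g ∈ selfArrows β i, ∀ ψ : CorePoint n → ℤ, ψ a = ψ a' → ψ b = ψ b' → ψ c = ψ c' →
      pairing β (arrowClass (Prod.map τ τ g) ∘ τ) ψ = pairing β (arrowClass g) ψ := by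
    intro g hg ψ e1 e2 e3
    by_cases hT : g = g₁ ∨ g = g₂ ∨ g = g₃
    · obtain ⟨-, k1, k2⟩ := mem_selfArrows.1 hg
      exact pairing_eq_of_local h₁ h₂ h₃ h₁₂ h₁₃ h₂₃ (offT g hg)
        (fun _ _ _ _ _ => ⟨rfl, rfl⟩) (local_one g hT k1 k2 _ ψ rfl e1 e2 e3)
    · obtain ⟨k, k1, k2, k3⟩ := generic g hg hT
      rw [k, invariant_comp _ k1 k2 k3]
  -- If either arrow is not in the triangle, its class is `τ`-invariant and `one` applies, through
  -- skew-symmetry when it is the first; `local_two` is needed only for two triangle arrows.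
  have two : ∀ g ∈ selfArrows β i, ∀ h ∈ selfArrows β i,
      pairing β (arrowClass (Prod.map τ τ g) ∘ τ) (arrowClass (Prod.map τ τ h) ∘ τ) =
        pairing β (arrowClass g) (arrowClass h) := by
    intro g hg h hh
    by_cases hT : h = g₁ ∨ h = g₂ ∨ h = g₃
    · by_cases gT : g = g₁ ∨ g = g₂ ∨ g = g₃
      · obtain ⟨-, k1, k2⟩ := mem_selfArrows.1 hg
        obtain ⟨-, k3, k4⟩ := mem_selfArrows.1 hh
        exact pairing_eq_of_local h₁ h₂ h₃ h₁₂ h₁₃ h₂₃ (offT g hg) (offT h hh)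
          (local_two g gT k1 k2 h hT k3 k4 _ _ rfl rfl)
      · obtain ⟨k, k1, k2, k3⟩ := generic g hg gT
        rw [k, invariant_comp _ k1 k2 k3, pairing_swap, one h hh _ k1 k2 k3, ← pairing_swap]
    · obtain ⟨k, k1, k2, k3⟩ := generic h hh hT
      rw [k, invariant_comp _ k1 k2 k3, one g hg _ k1 k2 k3]
  have circ : ∀ z, (τ z).1 = z.1 := by
    intro z
    by_cases hz : z = a ∨ z = a' ∨ z = b ∨ z = b' ∨ z = c ∨ z = c'
    · rcases hz with rfl | rfl | rfl | rfl | rfl | rfl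
      · rw [ta, tri.sameA]
      · rw [ta', tri.sameA]
      · rw [tb, tri.sameB]
      · rw [tb', tri.sameB]
      · rw [tc, tri.sameC]
      · rw [tc', tri.sameC]
    · rw [fix z hz]
  have hind : circleIndicator i ∘ τ = circleIndicator i := by
    funext z; exact circleIndicator_congr (circ z) i
  refine SameInvariants.of_image (Prod.map τ τ) (τ.injective.prodMap τ.injective).injOn
    (mem_selfArrows_image (fun z => by rw [circ]) image) ?_ ?_ ?_ ?_
  · rw [circleIndex, pairing_image τ.injective image, hind, circleIndex]; rfl
  · intro g hg
    rw [selfIndex, pairing_image τ.injective image, hind, selfIndex]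
    exact one g hg _ (circleIndicator_congr tri.sameA i) (circleIndicator_congr tri.sameB i)
      (circleIndicator_congr tri.sameC i)
  · intro g hg
    rw [totalIndex, pairing_image τ.injective image, totalIndex]
    exact one g hg 1 rfl rfl rfl
  · intro g hg h hh
    rw [pairing_image τ.injective image]
    exact two g hg h hh

theorem SameInvariants.of_cyclic_triangle {β β' : VirtualString n} {a a' b b' c c' : CorePoint n}
    (tri : IsTriangle a a' b b' c c')
    (freeA : Disjoint (openArc a a') β.endpoints) (freeB : Disjoint (openArc b b') β.endpoints)
    (freeC : Disjoint (openArc c c') β.endpoints)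
    (old : {(a', b), (b', c), (c', a)} ⊆ β.arrows)
    (replace : β'.arrows =
      (β.arrows \ {(a', b), (b', c), (c', a)}) ∪ {(a, b'), (b, c'), (c, a')}) (i : Fin n) :
    SameInvariants β i β' i := by
  obtain ⟨ta, ta', tb, tb', tc, tc'⟩ := tri.triangleSwap_apply
  obtain ⟨τ, hτ⟩ : ∃ τ, τ = triangleSwap a a' b b' c c' := ⟨_, rfl⟩
  rw [← hτ] at ta ta' tb tb' tc tc'
  have h₁ : (a', b) ∈ β.arrows := old (by simp)
  have h₂ : (b', c) ∈ β.arrows := old (by simp)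
  have h₃ : (c', a) ∈ β.arrows := old (by simp)
  have nAB := tri.ne_AB
  have nBC := tri.rotate.ne_AB
  have nCA := tri.rotate.rotate.ne_AB
  have sA := tri.sameA
  have sB := tri.sameB
  have sC := tri.sameC
  have third := tri.rotate.rotate
  refine SameInvariants.of_triangle tri freeA freeB freeC h₁ h₂ h₃ ?_ ?_ ?_ ?_ τ hτ ?_ i ?_ ?_ ?_
  · intro e; exact nAB.2.2.2 (Prod.ext_iff.1 e).1
  · intro e; exact nCA.2.2.2 (Prod.ext_iff.1 e).1.symm
  · intro e; exact nBC.2.2.2 (Prod.ext_iff.1 e).1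
  · rintro z (rfl | rfl | rfl | rfl | rfl | rfl) <;> simp
  · rw [replace]
    simp [Prod.map, ta, ta', tb, tb', tc, tc']
  · rintro g (rfl | rfl | rfl) k1 k2 z hA hB hC <;> dsimp only at k1 k2 <;>
      simp only [arrowClass, Prod.map_fst, Prod.map_snd, ta, ta', tb, tb', tc, tc']
    · obtain ⟨e1, e2, -⟩ := tri.arcWeight_congr (sA.trans (k1.trans k2.symm)) hA hB
      rw [e1, e2]
    · obtain ⟨e1, e2, -⟩ := tri.rotate.arcWeight_congr (sB.trans (k1.trans k2.symm)) hB hC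
      rw [e1, e2]
    · obtain ⟨e1, e2, -⟩ := third.arcWeight_congr (sC.trans (k1.trans k2.symm)) hC hA
      rw [e1, e2]
  · rintro g (rfl | rfl | rfl) k1 k2 φ ψ rfl eA eB eC <;> dsimp only at k1 k2 <;>
      simp only [arrowClass, arrowPairing, Function.comp, Prod.map_fst, Prod.map_snd,
        ta, ta', tb, tb', tc, tc', arcWeight_left, arcWeight_right, eA, eB, eC]
    · have hs := sA.trans (k1.trans k2.symm)
      obtain ⟨p1, p2, p3, p4, p5, p6, p7, p8⟩ := tri.arcWeight_pair hs
      obtain ⟨q1, q2, q3, q4, q5, q6, q7⟩ := tri.arcWeight_third hs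
      simp only [p1, p2, p3, p4, p5, p6, p7, p8, q1, q2, q3, q4, q5, q6, q7]
      ring
    · have hs := sB.trans (k1.trans k2.symm)
      obtain ⟨p1, p2, p3, p4, p5, p6, p7, p8⟩ := tri.rotate.arcWeight_pair hs
      obtain ⟨q1, q2, q3, q4, q5, q6, q7⟩ := tri.rotate.arcWeight_third hs
      simp only [p1, p2, p3, p4, p5, p6, p7, p8, q1, q2, q3, q4, q5, q6, q7]
      ring
    · have hs := sC.trans (k1.trans k2.symm)
      obtain ⟨p1, p2, p3, p4, p5, p6, p7, p8⟩ := third.arcWeight_pair hs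
      obtain ⟨q1, q2, q3, q4, q5, q6, q7⟩ := third.arcWeight_third hs
      simp only [p1, p2, p3, p4, p5, p6, p7, p8, q1, q2, q3, q4, q5, q6, q7]
      ring
  · intro g hg g1 g2 h hh h1 h2 φ ψ hφ hψ
    by_cases hgh : g = h
    · subst hgh
      rw [hφ, hψ]
      simp [arrowPairing]
    subst hφ hψ
    -- Two different arrows of the triangle already touch all three sides.
    have hs : a.1 = i ∧ b.1 = i ∧ c.1 = i := by
      rcases hg with rfl | rfl | rfl <;> rcases hh with rfl | rfl | rfl <;>
        simp_all
    have hab := hs.1.trans hs.2.1.symm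
    have hbc := hs.2.1.trans hs.2.2.symm
    obtain ⟨p1, p2, p3, p4, p5, p6, p7, p8⟩ := tri.arcWeight_pair hab
    obtain ⟨q1, q2, q3, q4, q5, q6, q7⟩ := tri.arcWeight_third hab
    obtain ⟨r1, r2, r3, r4, r5, r6, r7, r8⟩ := tri.rotate.arcWeight_pair hbc
    obtain ⟨s1, s2, s3, s4, s5, s6, s7⟩ := tri.rotate.arcWeight_third hbc
    obtain ⟨t1, t2, t3, t4, t5, t6, t7, t8⟩ := third.arcWeight_pair (hbc.symm.trans hab.symm)
    obtain ⟨u1, u2, u3, u4, u5, u6, u7⟩ := third.arcWeight_third (hbc.symm.trans hab.symm)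
    have v1 := tri.arcWeight_rotate hab hbc
    have v2 := tri.rotate.arcWeight_rotate hbc (hbc.symm.trans hab.symm)
    rw [v1] at v2
    rcases hg with rfl | rfl | rfl <;> rcases hh with rfl | rfl | rfl <;>
      first
      | exact absurd rfl hgh
      | (simp only [arrowClass, arrowPairing, Function.comp, Prod.map_fst, Prod.map_snd,
          ta, ta', tb, tb', tc, tc', arcWeight_left, arcWeight_right,
          p1, p2, p3, p4, p5, p6, p7, p8, q1, q2, q3, q4, q5, q6, q7,
          r1, r2, r3, r4, r5, r6, r7, r8, s1, s2, s3, s4, s5, s6, s7,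
          t1, t2, t3, t4, t5, t6, t7, t8, u1, u2, u3, u4, u5, u6, u7, v1, v2]
         ring)

/-- As in the cyclic case, except that the arrow from the first side to the third runs against the
cyclic order of the sides; hence the flipped triangle. -/
theorem SameInvariants.of_linear_triangle {β β' : VirtualString n} {a a' b b' c c' : CorePoint n}
    (tri : IsTriangle a a' b b' c c')
    (freeA : Disjoint (openArc a a') β.endpoints) (freeB : Disjoint (openArc b b') β.endpoints)
    (freeC : Disjoint (openArc c c') β.endpoints)
    (old : {(a, b), (a', c), (b', c')} ⊆ β.arrows)
    (replace : β'.arrows =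
      (β.arrows \ {(a, b), (a', c), (b', c')}) ∪ {(a', b'), (a, c'), (b, c)}) (i : Fin n) :
    SameInvariants β i β' i := by
  obtain ⟨ta, ta', tb, tb', tc, tc'⟩ := tri.triangleSwap_apply
  obtain ⟨τ, hτ⟩ : ∃ τ, τ = triangleSwap a a' b b' c c' := ⟨_, rfl⟩
  rw [← hτ] at ta ta' tb tb' tc tc'
  have h₁ : (a, b) ∈ β.arrows := old (by simp)
  have h₂ : (a', c) ∈ β.arrows := old (by simp)
  have h₃ : (b', c') ∈ β.arrows := old (by simp)
  have nAB := tri.ne_AB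
  have nBC := tri.rotate.ne_AB
  have sA := tri.sameA
  have sB := tri.sameB
  have sC := tri.sameC
  have flip := tri.rotate.rotate.flip
  refine SameInvariants.of_triangle tri freeA freeB freeC h₁ h₂ h₃ ?_ ?_ ?_ ?_ τ hτ ?_ i ?_ ?_ ?_
  · intro e; exact tri.neA (Prod.ext_iff.1 e).1
  · intro e; exact nAB.2.1 (Prod.ext_iff.1 e).1
  · intro e; exact nAB.2.2.2 (Prod.ext_iff.1 e).1
  · rintro z (rfl | rfl | rfl | rfl | rfl | rfl) <;> simp
  · rw [replace]
    simp [Prod.map, ta, ta', tb, tb', tc, tc']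
  · rintro g (rfl | rfl | rfl) k1 k2 z hA hB hC <;> dsimp only at k1 k2 <;>
      simp only [arrowClass, Prod.map_fst, Prod.map_snd, ta, ta', tb, tb', tc, tc']
    · obtain ⟨e1, e2, e3⟩ := tri.arcWeight_congr (k1.trans k2.symm) hA hB
      rw [e3]
    · obtain ⟨e1, e2, e3⟩ := flip.arcWeight_congr (sA.trans (k1.trans k2.symm)) hA hC
      rw [e1, e2]
    · obtain ⟨e1, e2, e3⟩ := tri.rotate.arcWeight_congr
        (sB.trans (k1.trans (k2.symm.trans sC.symm))) hB hC
      rw [e3]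
  · rintro g (rfl | rfl | rfl) k1 k2 φ ψ rfl eA eB eC <;> dsimp only at k1 k2 <;>
      simp only [arrowClass, arrowPairing, Function.comp, Prod.map_fst, Prod.map_snd,
        ta, ta', tb, tb', tc, tc', arcWeight_left, arcWeight_right, eA, eB, eC]
    · have hs := k1.trans k2.symm
      obtain ⟨p1, p2, p3, p4, p5, p6, p7, p8⟩ := tri.arcWeight_pair hs
      obtain ⟨q1, q2, q3, q4, q5, q6, q7⟩ := tri.arcWeight_third hs
      simp only [p1, p2, p3, p4, p5, p6, p7, p8, q1, q2, q3, q4, q5, q6, q7]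
      ring
    · have hs := sA.trans (k1.trans k2.symm)
      obtain ⟨p1, p2, p3, p4, p5, p6, p7, p8⟩ := flip.arcWeight_pair hs
      obtain ⟨q1, q2, q3, q4, q5, q6, q7⟩ := flip.arcWeight_third hs
      simp only [p1, p2, p3, p4, p5, p6, p7, p8, q1, q2, q3, q4, q5, q6, q7]
      ring
    · have hs := sB.trans (k1.trans (k2.symm.trans sC.symm))
      obtain ⟨p1, p2, p3, p4, p5, p6, p7, p8⟩ := tri.rotate.arcWeight_pair hs
      obtain ⟨q1, q2, q3, q4, q5, q6, q7⟩ := tri.rotate.arcWeight_third hs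
      simp only [p1, p2, p3, p4, p5, p6, p7, p8, q1, q2, q3, q4, q5, q6, q7]
      ring
  · intro g hg g1 g2 h hh h1 h2 φ ψ hφ hψ
    by_cases hgh : g = h
    · subst hgh
      rw [hφ, hψ]
      simp [arrowPairing]
    subst hφ hψ
    have hs : a.1 = i ∧ b.1 = i ∧ c.1 = i := by
      rcases hg with rfl | rfl | rfl <;> rcases hh with rfl | rfl | rfl <;>
        simp_all
    have hab := hs.1.trans hs.2.1.symm
    have hbc := hs.2.1.trans hs.2.2.symm
    obtain ⟨p1, p2, p3, p4, p5, p6, p7, p8⟩ := tri.arcWeight_pair hab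
    obtain ⟨q1, q2, q3, q4, q5, q6, q7⟩ := tri.arcWeight_third hab
    obtain ⟨r1, r2, r3, r4, r5, r6, r7, r8⟩ := tri.rotate.arcWeight_pair hbc
    obtain ⟨s1, s2, s3, s4, s5, s6, s7⟩ := tri.rotate.arcWeight_third hbc
    obtain ⟨t1, t2, t3, t4, t5, t6, t7, t8⟩ := flip.arcWeight_pair (hab.trans hbc)
    obtain ⟨u1, u2, u3, u4, u5, u6, u7⟩ := flip.arcWeight_third (hab.trans hbc)
    have v1 := tri.arcWeight_rotate hab hbc
    have v2 := tri.arcWeight_flip hab hbc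
    rcases hg with rfl | rfl | rfl <;> rcases hh with rfl | rfl | rfl <;>
      first
      | exact absurd rfl hgh
      | (simp only [arrowClass, arrowPairing, Function.comp, Prod.map_fst, Prod.map_snd,
          ta, ta', tb, tb', tc, tc', arcWeight_left, arcWeight_right,
          p1, p2, p3, p4, p5, p6, p7, p8, q1, q2, q3, q4, q5, q6, q7,
          r1, r2, r3, r4, r5, r6, r7, r8, s1, s2, s3, s4, s5, s6, s7,
          t1, t2, t3, t4, t5, t6, t7, t8, u1, u2, u3, u4, u5, u6, u7, v1, v2]
         ring)

/-! ### Invariance under virtual homotopy -/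

theorem Move.sameInvariants {β β' : VirtualString n} (h : Move β β') (i : Fin n) :
    SameInvariants β i β' i := by
  cases h with
  | type1a a b same free add_arrow =>
    exact .of_isolated_arrow (Or.inl rfl) same free add_arrow i
  | type1b a b same free add_arrow =>
    exact .of_isolated_arrow (Or.inr rfl) same free add_arrow i
  | type2 a a' b b' u u' v v' endsA endsB sameA sameB freeA freeB disj add_arrows =>
    exact .of_complementary_arrows endsA endsB sameA sameB freeA freeB disj add_arrows i
  | type3a a a' b b' c c' sameA sameB sameC freeA freeB freeC disjAB disjBC disjCA old replace =>
    have h₁ : (a', b) ∈ β.arrows := old (by simp)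
    have h₂ : (b', c) ∈ β.arrows := old (by simp)
    have h₃ : (c', a) ∈ β.arrows := old (by simp)
    exact .of_cyclic_triangle ⟨sameA, sameB, sameC, (β.tail_ne_head _ h₁ _ h₃).symm,
      (β.tail_ne_head _ h₂ _ h₁).symm, (β.tail_ne_head _ h₃ _ h₂).symm, disjAB, disjBC, disjCA⟩
      freeA freeB freeC old replace i
  | type3b a a' b b' c c' sameA sameB sameC freeA freeB freeC disjAB disjBC disjCA old replace =>
    have h₁ : (a, b) ∈ β.arrows := old (by simp)
    have h₂ : (a', c) ∈ β.arrows := old (by simp)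
    have h₃ : (b', c') ∈ β.arrows := old (by simp)
    -- Coinciding tails would make the two arrows equal, so that their heads `b` and `c` would
    -- coincide although their arcs are disjoint.
    have neA : a ≠ a' := fun e =>
      ne_of_disjoint_arc disjBC (left_mem_arc _ _) (left_mem_arc _ _)
        (Prod.ext_iff.1 (β.tail_injOn h₁ h₂ e)).2
    have neC : c ≠ c' := fun e =>
      ne_of_disjoint_arc disjAB (right_mem_arc sameA) (right_mem_arc sameB)
        (Prod.ext_iff.1 (β.head_injOn h₂ h₃ e)).1
    exact .of_linear_triangle ⟨sameA, sameB, sameC, neA, (β.tail_ne_head _ h₃ _ h₁).symm, neC,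
      disjAB, disjBC, disjCA⟩ freeA freeB freeC old replace i

theorem VirtuallyHomotopic.sameInvariants {β β' : VirtualString n}
    (h : VirtuallyHomotopic β β') :
    ∃ σ : Equiv.Perm (Fin n), ∀ i, SameInvariants β i β' (σ i) := by
  induction h with
  | rel x y h =>
    rcases h with h | h
    · exact h.sameInvariants
    · exact ⟨1, h.sameInvariants⟩
  | refl x => exact ⟨1, SameInvariants.refl x⟩
  | symm x y _ ih =>
    obtain ⟨σ, hσ⟩ := ih
    exact ⟨σ⁻¹, fun i => by simpa using (hσ (σ⁻¹ i)).symm⟩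
  | trans x y z _ _ ih₁ ih₂ =>
    obtain ⟨σ, hσ⟩ := ih₁
    obtain ⟨ρ, hρ⟩ := ih₂
    exact ⟨ρ * σ, fun i => (hσ i).trans (hρ (σ i))⟩

end VirtualString

/-! ### Cyclic order of the clusters -/

theorem UnitAddCircle.sbtw_coe_of_lt {x y z : ℝ} (hxy : x < y) (hyz : y < z) (hzx : z < x + 1) :
    sbtw (x : UnitAddCircle) (y : UnitAddCircle) (z : UnitAddCircle) := by
  rw [sbtw_iff_not_btw]
  have h := QuotientAddGroup.btw_coe_iff (p := (1 : ℝ)) (x₁ := z) (x₂ := y) (x₃ := x)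
  refine fun hb => absurd (h.1 hb) ?_
  -- Measured from `z`, the points `x` and `y` are first met one period later, and still in the
  -- order `x`, `y`.
  have e1 : toIcoMod (zero_lt_one' ℝ) z y = y + 1 := by
    rw [toIcoMod_eq_iff]
    exact ⟨⟨by linarith, by linarith⟩, -1, by simp⟩
  have e2 : toIocMod (zero_lt_one' ℝ) z x = x + 1 := by
    rw [toIocMod_eq_iff]
    exact ⟨⟨by linarith, by linarith⟩, -1, by simp⟩
  have e1' : toIcoMod (Fact.out : (0 : ℝ) < 1) z y = y + 1 := e1
  have e2' : toIocMod (Fact.out : (0 : ℝ) < 1) z x = x + 1 := e2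
  rw [e1', e2']
  linarith

/-- The real number in `(0, 1)` representing `clusterPoint k i`. -/
noncomputable def clusterPosition (k : Fin 8) {N : ℕ} (i : Fin N) : ℝ :=
  ((k : ℕ) + ((i : ℕ) + 1) / (N + 1)) / 8

theorem clusterPosition_bounds (k : Fin 8) {N : ℕ} (i : Fin N) :
    ((k : ℕ) : ℝ) / 8 < clusterPosition k i ∧ clusterPosition k i < (((k : ℕ) : ℝ) + 1) / 8 := by
  have hi : ((i : ℕ) : ℝ) < N := by exact_mod_cast i.2
  have h0 : (0 : ℝ) < (((i : ℕ) : ℝ) + 1) / (N + 1) := by positivity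
  have h1 : (((i : ℕ) : ℝ) + 1) / (N + 1) < 1 := by
    rw [div_lt_one (by positivity)]; linarith
  unfold clusterPosition
  constructor <;> linarith

theorem clusterPosition_lt_of_lt {k k' : Fin 8} (h : k < k') {N N' : ℕ} (i : Fin N) (i' : Fin N') :
    clusterPosition k i < clusterPosition k' i' := by
  have h1 := (clusterPosition_bounds k i).2
  have h2 := (clusterPosition_bounds k' i').1
  have h3 : (((k : ℕ) : ℝ) + 1) ≤ ((k' : ℕ) : ℝ) := by exact_mod_cast h
  linarith

theorem clusterPosition_lt_of_index_lt (k : Fin 8) {N : ℕ} {i j : Fin N} (h : i < j) :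
    clusterPosition k i < clusterPosition k j := by
  have h3 : (((i : ℕ) : ℝ)) < ((j : ℕ) : ℝ) := by exact_mod_cast h
  unfold clusterPosition
  gcongr

theorem sbtw_clusterPoint {k k' k'' : Fin 8} {N N' N'' : ℕ} {i : Fin N} {i' : Fin N'}
    {i'' : Fin N''} (h : clusterPosition k i < clusterPosition k' i')
    (h' : clusterPosition k' i' < clusterPosition k'' i'') :
    sbtw (clusterPoint k i) (clusterPoint k' i') (clusterPoint k'' i'') := by
  refine UnitAddCircle.sbtw_coe_of_lt h h' ?_
  have h1 := (clusterPosition_bounds k'' i'').2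
  have h2 := (clusterPosition_bounds k i).1
  have h3 : (((k'' : ℕ) : ℝ) + 1) ≤ 8 := by exact_mod_cast k''.2
  have h4 : (0 : ℝ) ≤ ((k : ℕ) : ℝ) := by positivity
  simp only [clusterPosition] at h1 h2 ⊢
  linarith

/-- The weight of the `l`-th of several parallel arrows with respect to the `i`-th one. -/
def parallelWeight {N : ℕ} (i l : Fin N) : ℤ := if l = i then 1 else if i < l then 2 else 0

theorem parallelWeight_of_last {N : ℕ} {i : Fin N} (hi : (i : ℕ) + 1 = N) (l : Fin N) :
    parallelWeight i l = if l = i then 1 else 0 := by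
  have : ¬ i < l := by
    intro h
    have h' : (i : ℕ) < l := h
    omega
  simp [parallelWeight, this]

/-! ### Weights of parallel arrows -/

namespace VirtualString

section ParallelArrows

variable {n N : ℕ}

theorem arcWeight_cluster_eq_zero_of_mem (c : Fin n) {k k' : Fin 8} (hk : k' < k) (i : Fin N)
    {z : CorePoint n} (hz : z ∈ openArc (c, clusterPoint k' i.rev) (c, clusterPoint k i)) :
    arcWeight (c, clusterPoint k i) (c, clusterPoint k' i.rev) z = 0 := by
  rw [arcWeight_swap (a := (c, clusterPoint k' i.rev)) (b := (c, clusterPoint k i)) rfl,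
    arcWeight_of_mem hz]
  · simp [circleIndicator, show z.1 = c from hz.1]
  · intro e
    exact clusterPoint_ne hk.ne _ _ (Prod.ext_iff.1 e).2

/-- Since `k' < k`, the positive arc from tail to head passes through the base point `0`. It covers
the clusters beyond `k` and before `k'`, and misses those in between. -/
theorem arcWeight_cluster_after (c : Fin n) {k k' κ : Fin 8} (hk : k' < k) (h : k < κ)
    (i : Fin N) {M : ℕ} (j : Fin M) :
    arcWeight (c, clusterPoint k i) (c, clusterPoint k' i.rev) (c, clusterPoint κ j) = 2 :=
  arcWeight_of_mem ⟨rfl, (sbtw_clusterPoint (clusterPosition_lt_of_lt hk i.rev i)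
    (clusterPosition_lt_of_lt h i j)).cyclic_left⟩

theorem arcWeight_cluster_before (c : Fin n) {k k' κ : Fin 8} (hk : k' < k) (h : κ < k')
    (i : Fin N) {M : ℕ} (j : Fin M) :
    arcWeight (c, clusterPoint k i) (c, clusterPoint k' i.rev) (c, clusterPoint κ j) = 2 :=
  arcWeight_of_mem ⟨rfl, (sbtw_clusterPoint (clusterPosition_lt_of_lt h j i.rev)
    (clusterPosition_lt_of_lt hk i.rev i)).cyclic_right⟩

theorem arcWeight_cluster_between (c : Fin n) {k k' κ : Fin 8} (h : k' < κ) (h' : κ < k)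
    (i : Fin N) {M : ℕ} (j : Fin M) :
    arcWeight (c, clusterPoint k i) (c, clusterPoint k' i.rev) (c, clusterPoint κ j) = 0 :=
  arcWeight_cluster_eq_zero_of_mem c (h.trans h') i
    ⟨rfl, sbtw_clusterPoint (clusterPosition_lt_of_lt h i.rev j) (clusterPosition_lt_of_lt h' j i)⟩

theorem arcWeight_cluster_tail (c : Fin n) {k k' : Fin 8} (hk : k' < k) (i l : Fin N) :
    arcWeight (c, clusterPoint k i) (c, clusterPoint k' i.rev) (c, clusterPoint k l) =
      parallelWeight i l := by
  rcases lt_trichotomy l i with h | rfl | h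
  · refine (arcWeight_cluster_eq_zero_of_mem c hk i (z := (c, clusterPoint k l))
      ⟨rfl, sbtw_clusterPoint (clusterPosition_lt_of_lt hk i.rev l)
        (clusterPosition_lt_of_index_lt k h)⟩).trans ?_
    simp [parallelWeight, h.ne, h.not_gt]
  · simp [parallelWeight]
  · refine (arcWeight_of_mem (a := (c, clusterPoint k i)) (z := (c, clusterPoint k l))
      ⟨rfl, (sbtw_clusterPoint (clusterPosition_lt_of_lt hk i.rev i)
        (clusterPosition_lt_of_index_lt k h)).cyclic_left⟩).trans ?_
    simp [h.ne', parallelWeight, h]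

/-- Because heads occur in reverse order, the arcs of parallel arrows are nested. So both ends of a
parallel arrow have the same weight, and the arc of the last arrow contains none of the others. -/
theorem arcWeight_cluster_head (c : Fin n) {k k' : Fin 8} (hk : k' < k) (i l : Fin N) :
    arcWeight (c, clusterPoint k i) (c, clusterPoint k' i.rev) (c, clusterPoint k' l.rev) =
      parallelWeight i l := by
  rcases lt_trichotomy l i with h | rfl | h
  · refine (arcWeight_cluster_eq_zero_of_mem c hk i (z := (c, clusterPoint k' l.rev))
      ⟨rfl, sbtw_clusterPoint (clusterPosition_lt_of_index_lt k' (Fin.rev_lt_rev.2 h))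
      (clusterPosition_lt_of_lt hk l.rev i)⟩).trans ?_
    simp [parallelWeight, h.ne, h.not_gt]
  · simp [parallelWeight]
  · refine (arcWeight_of_mem (a := (c, clusterPoint k i)) (z := (c, clusterPoint k' l.rev))
      ⟨rfl, (sbtw_clusterPoint (clusterPosition_lt_of_index_lt k' (Fin.rev_lt_rev.2 h))
      (clusterPosition_lt_of_lt hk i.rev i)).cyclic_right⟩).trans ?_
    simp [h.ne', parallelWeight, h]

/-- The `i`-th of `N` parallel arrows on the circle `c`, from the cluster `k` to the cluster
`k'`. -/
noncomputable def parallelArrow (c : Fin n) (k k' : Fin 8) (i : Fin N) :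
    CorePoint n × CorePoint n :=
  ((c, clusterPoint k i), (c, clusterPoint k' i.rev))

theorem arrowClass_parallelArrow_of_ne {c d : Fin n} (h : d ≠ c) (k k' : Fin 8) (i : Fin N)
    (x : UnitAddCircle) : arrowClass (parallelArrow c k k' i) (d, x) = 0 :=
  arcWeight_of_fst_ne rfl h

end ParallelArrows

/-- The weights of the arrows from left to right. -/
theorem arrowClass_horizontal {n N : ℕ} (c : Fin n) (i : Fin N) :
    (∀ l, arrowClass (parallelArrow c 4 0 i) (c, clusterPoint 0 (Fin.rev l)) = parallelWeight i l) ∧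
    (∀ {M : ℕ} (j : Fin M), arrowClass (parallelArrow c 4 0 i) (c, clusterPoint 1 j) = 0) ∧
    (∀ {M : ℕ} (j : Fin M), arrowClass (parallelArrow c 4 0 i) (c, clusterPoint 2 j) = 0) ∧
    (∀ l, arrowClass (parallelArrow c 4 0 i) (c, clusterPoint 4 l) = parallelWeight i l) ∧
    (∀ {M : ℕ} (j : Fin M), arrowClass (parallelArrow c 4 0 i) (c, clusterPoint 5 j) = 2) ∧
    (∀ {M : ℕ} (j : Fin M), arrowClass (parallelArrow c 4 0 i) (c, clusterPoint 6 j) = 2) :=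
  ⟨fun l => arcWeight_cluster_head c (by decide) i l,
    fun j => arcWeight_cluster_between c (by decide) (by decide) i j,
    fun j => arcWeight_cluster_between c (by decide) (by decide) i j,
    fun l => arcWeight_cluster_tail c (by decide) i l,
    fun j => arcWeight_cluster_after c (by decide) (by decide) i j,
    fun j => arcWeight_cluster_after c (by decide) (by decide) i j⟩

/-- The weights of the arrows from bottom to top. -/
theorem arrowClass_vertical {n N : ℕ} (c : Fin n) (i : Fin N) :
    (∀ {M : ℕ} (j : Fin M), arrowClass (parallelArrow c 6 2 i) (c, clusterPoint 0 j) = 2) ∧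
    (∀ {M : ℕ} (j : Fin M), arrowClass (parallelArrow c 6 2 i) (c, clusterPoint 1 j) = 2) ∧
    (∀ l, arrowClass (parallelArrow c 6 2 i) (c, clusterPoint 2 (Fin.rev l)) = parallelWeight i l) ∧
    (∀ {M : ℕ} (j : Fin M), arrowClass (parallelArrow c 6 2 i) (c, clusterPoint 4 j) = 0) ∧
    (∀ {M : ℕ} (j : Fin M), arrowClass (parallelArrow c 6 2 i) (c, clusterPoint 5 j) = 0) ∧
    (∀ l, arrowClass (parallelArrow c 6 2 i) (c, clusterPoint 6 l) = parallelWeight i l) :=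
  ⟨fun j => arcWeight_cluster_before c (by decide) (by decide) i j,
    fun j => arcWeight_cluster_before c (by decide) (by decide) i j,
    fun l => arcWeight_cluster_head c (by decide) i l,
    fun j => arcWeight_cluster_between c (by decide) (by decide) i j,
    fun j => arcWeight_cluster_between c (by decide) (by decide) i j,
    fun l => arcWeight_cluster_tail c (by decide) i l⟩

/-! ### Loops and intersection numbers in the family -/

/-- A circle whose self-arrows form two families of `p` and `q` parallel arrows crossing each
other. -/
structure IsCrossing {n : ℕ} (β : VirtualString n) (c : Fin n) (p q : ℕ) (m t : ℤ)
    (E : Fin p → CorePoint n × CorePoint n) (F : Fin q → CorePoint n × CorePoint n) : Prop where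
  sum_selfArrows : ∀ f : CorePoint n × CorePoint n → ℤ,
    ∑ g ∈ selfArrows β c, f g = ∑ i, f (E i) + ∑ j, f (F j)
  circleIndex_eq : circleIndex β c = m
  selfIndex_left : ∀ i, selfIndex β c (E i) = 2 * q
  totalIndex_left : ∀ i, totalIndex β (E i) = 2 * q + 2 * t
  selfIndex_right : ∀ j, selfIndex β c (F j) = -(2 * p)
  totalIndex_right : ∀ j, totalIndex β (F j) = 2 * m - (2 * p + 2 * t)
  pairing_left : ∀ i j, pairing β (arrowClass (E i)) (arrowClass (E j)) = 0
  pairing_right : ∀ i j, pairing β (arrowClass (F i)) (arrowClass (F j)) = 0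
  pairing_last : ∀ (i : Fin p) (j : Fin q), (i : ℕ) + 1 = p → (j : ℕ) + 1 = q →
    pairing β (arrowClass (E i)) (arrowClass (F j)) = 4

section Beta

variable (p₁ q₁ p₂ q₂ r s : ℕ)

theorem sum_arrows_betaString (f : CorePoint 2 × CorePoint 2 → ℤ) :
    ∑ g ∈ (betaString p₁ q₁ p₂ q₂ r s).finite_arrows.toFinset, f g =
      ∑ x : BetaIndex p₁ q₁ p₂ q₂ r s, f (betaTail x, betaHead x) := by
  classical
  have e : (betaString p₁ q₁ p₂ q₂ r s).finite_arrows.toFinset =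
      Finset.univ.image fun x : BetaIndex p₁ q₁ p₂ q₂ r s => (betaTail x, betaHead x) := by
    ext g; simp [betaString]
  rw [e, Finset.sum_image]
  intro x _ y _ h
  exact betaTail_injective (Prod.ext_iff.1 h).1

/-- The loop of a horizontal arrow covers clusters 5 and 6 but not 1 and 2: each vertical arrow
contributes `2`, and each of the `s` incoming arrows contributes `-2` to the total index. -/
theorem isCrossing_betaString_zero : IsCrossing (betaString p₁ q₁ p₂ q₂ r s) 0 p₁ q₁ (r - s) (-s)
    (parallelArrow 0 4 0) (parallelArrow 0 6 2) := by
  constructor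
  · intro f
    rw [selfArrows, Finset.sum_filter, sum_arrows_betaString]
    simp [betaTail, betaHead, parallelArrow]
  · rw [circleIndex, pairing, sum_arrows_betaString]
    simp [arrowPairing, betaTail, betaHead, circleIndicator]
  · intro i
    obtain ⟨h0, h1, h2, h4, h5, h6⟩ := arrowClass_horizontal (0 : Fin 2) i
    have h : ∀ x, arrowClass (parallelArrow (0 : Fin 2) 4 0 i) (1, x) = 0 :=
      arrowClass_parallelArrow_of_ne (by decide) _ _ _
    rw [selfIndex, pairing, sum_arrows_betaString]
    simp only [Fintype.sum_sum_type, arrowPairing, betaTail, betaHead, circleIndicator,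
      Pi.one_apply, h0, h1, h2, h4, h5, h6, h]
    simp
    ring
  · intro i
    obtain ⟨h0, h1, h2, h4, h5, h6⟩ := arrowClass_horizontal (0 : Fin 2) i
    have h : ∀ x, arrowClass (parallelArrow (0 : Fin 2) 4 0 i) (1, x) = 0 :=
      arrowClass_parallelArrow_of_ne (by decide) _ _ _
    rw [totalIndex, pairing, sum_arrows_betaString]
    simp only [Fintype.sum_sum_type, arrowPairing, betaTail, betaHead, circleIndicator,
      Pi.one_apply, h0, h1, h2, h4, h5, h6, h]
    simp
    ring
  · intro i
    obtain ⟨h0, h1, h2, h4, h5, h6⟩ := arrowClass_vertical (0 : Fin 2) i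
    have h : ∀ x, arrowClass (parallelArrow (0 : Fin 2) 6 2 i) (1, x) = 0 :=
      arrowClass_parallelArrow_of_ne (by decide) _ _ _
    rw [selfIndex, pairing, sum_arrows_betaString]
    simp only [Fintype.sum_sum_type, arrowPairing, betaTail, betaHead, circleIndicator,
      Pi.one_apply, h0, h1, h2, h4, h5, h6, h]
    simp
    ring
  · intro i
    obtain ⟨h0, h1, h2, h4, h5, h6⟩ := arrowClass_vertical (0 : Fin 2) i
    have h : ∀ x, arrowClass (parallelArrow (0 : Fin 2) 6 2 i) (1, x) = 0 :=
      arrowClass_parallelArrow_of_ne (by decide) _ _ _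
    rw [totalIndex, pairing, sum_arrows_betaString]
    simp only [Fintype.sum_sum_type, arrowPairing, betaTail, betaHead, circleIndicator,
      Pi.one_apply, h0, h1, h2, h4, h5, h6, h]
    simp
    ring
  · intro i j
    obtain ⟨h0, h1, h2, h4, h5, h6⟩ := arrowClass_horizontal (0 : Fin 2) i
    obtain ⟨k0, k1, k2, k4, k5, k6⟩ := arrowClass_horizontal (0 : Fin 2) j
    have h : ∀ x, arrowClass (parallelArrow (0 : Fin 2) 4 0 i) (1, x) = 0 :=
      arrowClass_parallelArrow_of_ne (by decide) _ _ _
    have k : ∀ x, arrowClass (parallelArrow (0 : Fin 2) 4 0 j) (1, x) = 0 :=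
      arrowClass_parallelArrow_of_ne (by decide) _ _ _
    rw [pairing, sum_arrows_betaString]
    refine Finset.sum_eq_zero ?_
    rintro ((x | x) | (x | x) | (x | x)) - <;>
      simp only [arrowPairing, betaTail, betaHead, h0, h1, h2, h4, h5, h6, h,
        k0, k1, k2, k4, k5, k6, k] <;> ring
  · intro i j
    obtain ⟨h0, h1, h2, h4, h5, h6⟩ := arrowClass_vertical (0 : Fin 2) i
    obtain ⟨k0, k1, k2, k4, k5, k6⟩ := arrowClass_vertical (0 : Fin 2) j
    have h : ∀ x, arrowClass (parallelArrow (0 : Fin 2) 6 2 i) (1, x) = 0 :=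
      arrowClass_parallelArrow_of_ne (by decide) _ _ _
    have k : ∀ x, arrowClass (parallelArrow (0 : Fin 2) 6 2 j) (1, x) = 0 :=
      arrowClass_parallelArrow_of_ne (by decide) _ _ _
    rw [pairing, sum_arrows_betaString]
    refine Finset.sum_eq_zero ?_
    rintro ((x | x) | (x | x) | (x | x)) - <;>
      simp only [arrowPairing, betaTail, betaHead, h0, h1, h2, h4, h5, h6, h,
        k0, k1, k2, k4, k5, k6, k] <;> ring
  · intro i j hi hj
    obtain ⟨h0, h1, h2, h4, h5, h6⟩ := arrowClass_horizontal (0 : Fin 2) i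
    obtain ⟨k0, k1, k2, k4, k5, k6⟩ := arrowClass_vertical (0 : Fin 2) j
    have h : ∀ x, arrowClass (parallelArrow (0 : Fin 2) 4 0 i) (1, x) = 0 :=
      arrowClass_parallelArrow_of_ne (by decide) _ _ _
    have k : ∀ x, arrowClass (parallelArrow (0 : Fin 2) 6 2 j) (1, x) = 0 :=
      arrowClass_parallelArrow_of_ne (by decide) _ _ _
    rw [pairing, sum_arrows_betaString]
    -- For the last arrows of both families only these two arrows contribute, `2` each.
    simp only [Fintype.sum_sum_type, arrowPairing, betaTail, betaHead, h0, h1, h2, h4, h5, h6, h,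
      k0, k1, k2, k4, k5, k6, k, parallelWeight_of_last hi, parallelWeight_of_last hj]
    simp

theorem isCrossing_betaString_one : IsCrossing (betaString p₁ q₁ p₂ q₂ r s) 1 p₂ q₂ (s - r) s
    (parallelArrow 1 4 0) (parallelArrow 1 6 2) := by
  constructor
  · intro f
    rw [selfArrows, Finset.sum_filter, sum_arrows_betaString]
    simp [betaTail, betaHead, parallelArrow]
  · rw [circleIndex, pairing, sum_arrows_betaString]
    simp [arrowPairing, betaTail, betaHead, circleIndicator]
  · intro i
    obtain ⟨h0, h1, h2, h4, h5, h6⟩ := arrowClass_horizontal (1 : Fin 2) i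
    have h : ∀ x, arrowClass (parallelArrow (1 : Fin 2) 4 0 i) (0, x) = 0 :=
      arrowClass_parallelArrow_of_ne (by decide) _ _ _
    rw [selfIndex, pairing, sum_arrows_betaString]
    simp only [Fintype.sum_sum_type, arrowPairing, betaTail, betaHead, circleIndicator,
      Pi.one_apply, h0, h1, h2, h4, h5, h6, h]
    simp
    ring
  · intro i
    obtain ⟨h0, h1, h2, h4, h5, h6⟩ := arrowClass_horizontal (1 : Fin 2) i
    have h : ∀ x, arrowClass (parallelArrow (1 : Fin 2) 4 0 i) (0, x) = 0 :=
      arrowClass_parallelArrow_of_ne (by decide) _ _ _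
    rw [totalIndex, pairing, sum_arrows_betaString]
    simp only [Fintype.sum_sum_type, arrowPairing, betaTail, betaHead, circleIndicator,
      Pi.one_apply, h0, h1, h2, h4, h5, h6, h]
    simp
    ring
  · intro i
    obtain ⟨h0, h1, h2, h4, h5, h6⟩ := arrowClass_vertical (1 : Fin 2) i
    have h : ∀ x, arrowClass (parallelArrow (1 : Fin 2) 6 2 i) (0, x) = 0 :=
      arrowClass_parallelArrow_of_ne (by decide) _ _ _
    rw [selfIndex, pairing, sum_arrows_betaString]
    simp only [Fintype.sum_sum_type, arrowPairing, betaTail, betaHead, circleIndicator,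
      Pi.one_apply, h0, h1, h2, h4, h5, h6, h]
    simp
    ring
  · intro i
    obtain ⟨h0, h1, h2, h4, h5, h6⟩ := arrowClass_vertical (1 : Fin 2) i
    have h : ∀ x, arrowClass (parallelArrow (1 : Fin 2) 6 2 i) (0, x) = 0 :=
      arrowClass_parallelArrow_of_ne (by decide) _ _ _
    rw [totalIndex, pairing, sum_arrows_betaString]
    simp only [Fintype.sum_sum_type, arrowPairing, betaTail, betaHead, circleIndicator,
      Pi.one_apply, h0, h1, h2, h4, h5, h6, h]
    simp
    ring
  · intro i j
    obtain ⟨h0, h1, h2, h4, h5, h6⟩ := arrowClass_horizontal (1 : Fin 2) i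
    obtain ⟨k0, k1, k2, k4, k5, k6⟩ := arrowClass_horizontal (1 : Fin 2) j
    have h : ∀ x, arrowClass (parallelArrow (1 : Fin 2) 4 0 i) (0, x) = 0 :=
      arrowClass_parallelArrow_of_ne (by decide) _ _ _
    have k : ∀ x, arrowClass (parallelArrow (1 : Fin 2) 4 0 j) (0, x) = 0 :=
      arrowClass_parallelArrow_of_ne (by decide) _ _ _
    rw [pairing, sum_arrows_betaString]
    refine Finset.sum_eq_zero ?_
    rintro ((x | x) | (x | x) | (x | x)) - <;>
      simp only [arrowPairing, betaTail, betaHead, h0, h1, h2, h4, h5, h6, h,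
        k0, k1, k2, k4, k5, k6, k] <;> ring
  · intro i j
    obtain ⟨h0, h1, h2, h4, h5, h6⟩ := arrowClass_vertical (1 : Fin 2) i
    obtain ⟨k0, k1, k2, k4, k5, k6⟩ := arrowClass_vertical (1 : Fin 2) j
    have h : ∀ x, arrowClass (parallelArrow (1 : Fin 2) 6 2 i) (0, x) = 0 :=
      arrowClass_parallelArrow_of_ne (by decide) _ _ _
    have k : ∀ x, arrowClass (parallelArrow (1 : Fin 2) 6 2 j) (0, x) = 0 :=
      arrowClass_parallelArrow_of_ne (by decide) _ _ _
    rw [pairing, sum_arrows_betaString]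
    refine Finset.sum_eq_zero ?_
    rintro ((x | x) | (x | x) | (x | x)) - <;>
      simp only [arrowPairing, betaTail, betaHead, h0, h1, h2, h4, h5, h6, h,
        k0, k1, k2, k4, k5, k6, k] <;> ring
  · intro i j hi hj
    obtain ⟨h0, h1, h2, h4, h5, h6⟩ := arrowClass_horizontal (1 : Fin 2) i
    obtain ⟨k0, k1, k2, k4, k5, k6⟩ := arrowClass_vertical (1 : Fin 2) j
    have h : ∀ x, arrowClass (parallelArrow (1 : Fin 2) 4 0 i) (0, x) = 0 :=
      arrowClass_parallelArrow_of_ne (by decide) _ _ _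
    have k : ∀ x, arrowClass (parallelArrow (1 : Fin 2) 6 2 j) (0, x) = 0 :=
      arrowClass_parallelArrow_of_ne (by decide) _ _ _
    rw [pairing, sum_arrows_betaString]
    simp only [Fintype.sum_sum_type, arrowPairing, betaTail, betaHead, h0, h1, h2, h4, h5, h6, h,
      k0, k1, k2, k4, k5, k6, k, parallelWeight_of_last hi, parallelWeight_of_last hj]
    simp

end Beta

end VirtualString

/-! ### Recovering the parameters from the invariants -/

namespace VirtualString

section Crossing

variable {n : ℕ} {β : VirtualString n} {c : Fin n} {p q : ℕ} {m t : ℤ}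
  {E : Fin p → CorePoint n × CorePoint n} {F : Fin q → CorePoint n × CorePoint n}

theorem IsCrossing.linearInvariant_eq (h : IsCrossing β c p q m t E F) {k : ℤ} (hk : 0 < k)
    (l : ℤ) : linearInvariant β c k l =
      p * (if (2 * q : ℤ) = k ∧ 2 * q + 2 * t = l then 1 else 0) -
      q * (if (2 * p : ℤ) = k ∧ 2 * p + 2 * t = l then 1 else 0) := by
  have h1 : ¬ (-(2 * q : ℤ) = k) := by omega
  have h2 : ¬ (-(2 * p : ℤ) = k) := by omega
  rw [linearInvariant, h.sum_selfArrows]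
  simp only [h.circleIndex_eq, h.selfIndex_left, h.totalIndex_left, h.selfIndex_right,
    h.totalIndex_right, linearTerm, neg_neg, sub_sub_cancel, h1, h2, false_and, if_false]
  simp [Finset.sum_const, sub_eq_add_neg]

/-- For `k > 0` only loops along the `E i` and complements of loops along the `F j` count. Two of
the same kind have intersection number zero. A mixed pair has sign `-` and intersection number `2 *
(2 * q) - b`, and occurs in both orders. -/
theorem IsCrossing.quadraticInvariant_eq (h : IsCrossing β c p q m t E F) {k : ℤ} (hk : 0 < k)
    (l : ℤ) : quadraticInvariant β c k l =
      -2 * ((if (2 * q : ℤ) = k ∧ 2 * q + 2 * t = l then 1 else 0) *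
      (if (2 * p : ℤ) = k ∧ 2 * p + 2 * t = l then 1 else 0) *
      ∑ i, ∑ j, (4 * q - pairing β (arrowClass (E i)) (arrowClass (F j))) ^ 2) := by
  have h1 : ¬ (-(2 * q : ℤ) = k) := by omega
  have h2 : ¬ (-(2 * p : ℤ) = k) := by omega
  have ee : ∀ i j, quadraticWeight β c k l (E i) (E j) = 0 := by
    intro i j
    simp [quadraticWeight, quadraticTerm, h.selfIndex_left, h.pairing_left, h1]
  have ff : ∀ i j, quadraticWeight β c k l (F i) (F j) = 0 := by
    intro i j
    simp [quadraticWeight, quadraticTerm, h.selfIndex_right, h.pairing_right, h2]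
  have ef : ∀ i j, quadraticWeight β c k l (E i) (F j) =
      -((if (2 * q : ℤ) = k ∧ 2 * q + 2 * t = l then 1 else 0) *
      (if (2 * p : ℤ) = k ∧ 2 * p + 2 * t = l then 1 else 0) *
        (4 * q - pairing β (arrowClass (E i)) (arrowClass (F j))) ^ 2) := by
    intro i j
    simp only [quadraticWeight, quadraticTerm, h.circleIndex_eq, h.selfIndex_left,
      h.totalIndex_left, h.selfIndex_right, h.totalIndex_right, neg_neg, sub_sub_cancel, h1, h2,
      false_and, if_false]
    ring
  have fe : ∀ i j, quadraticWeight β c k l (F j) (E i) = quadraticWeight β c k l (E i) (F j) :=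
    fun i j => quadraticWeight_symm _ _ _ _ _ _
  rw [quadraticInvariant, h.sum_selfArrows]
  simp only [h.sum_selfArrows, ee, ff, fe, ef, Finset.sum_const_zero, zero_add, add_zero]
  rw [Finset.sum_comm (s := (Finset.univ : Finset (Fin q)))]
  simp only [Finset.sum_neg_distrib, ← Finset.mul_sum]
  ring

theorem IsCrossing.sum_sq_pos (h : IsCrossing β c p q m t E F) (hp : 0 < p) (hq : 2 ≤ q) :
    0 < ∑ i, ∑ j, (4 * q - pairing β (arrowClass (E i)) (arrowClass (F j))) ^ 2 := by
  -- The last arrows of the two families give the base `4 * q - 4`, which is nonzero exactly because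
  -- `q ≠ 1`.
  refine Finset.sum_pos' (fun i _ => Finset.sum_nonneg fun j _ => sq_nonneg _)
    ⟨⟨p - 1, by omega⟩, Finset.mem_univ _, ?_⟩
  refine Finset.sum_pos' (fun j _ => sq_nonneg _) ⟨⟨q - 1, by omega⟩, Finset.mem_univ _, ?_⟩
  rw [h.pairing_last _ _ (Nat.sub_add_cancel hp) (Nat.sub_add_cancel (by omega : 1 ≤ q))]
  have : (4 * q - 4 : ℤ) ≠ 0 := by omega
  positivity

/-- The parameters of a crossing of two families of parallel arrows are determined by the
invariants of the circle. -/
theorem IsCrossing.parameters_eq (h : IsCrossing β c p q m t E F)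
    {β' : VirtualString n} {c' : Fin n} {p' q' : ℕ} {m' t' : ℤ}
    {E' : Fin p' → CorePoint n × CorePoint n} {F' : Fin q' → CorePoint n × CorePoint n}
    (h' : IsCrossing β' c' p' q' m' t' E' F') (same : SameInvariants β c β' c')
    (hp : 0 < p) (hq : 0 < q) (hpq : ¬(p = 1 ∧ q = 1)) (hp' : 0 < p') (hq' : 0 < q') :
    p = p' ∧ q = q' ∧ t = t' ∧ m = m' := by
  have hm : m = m' := by rw [← h.circleIndex_eq, ← h'.circleIndex_eq, same.circleIndex_eq]
  have lin : ∀ k l : ℤ, 0 < k → _ := fun k l hk => by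
    have e := same.linear_eq k l hk.ne'
    rw [h.linearInvariant_eq hk, h'.linearInvariant_eq hk] at e
    exact e
  have quad : ∀ k l : ℤ, 0 < k → _ := fun k l hk => by
    have e := same.quadratic_eq k l hk.ne'
    rw [h.quadraticInvariant_eq hk, h'.quadraticInvariant_eq hk] at e
    exact e
  by_cases hne : p = q
  · subst hne
    -- For `p = q` the linear invariant is zero, whereas for `p' ≠ q'` it has the value `p'` at the
    -- label of the horizontal loops.
    have hpq' : p' = q' := by
      by_contra hc
      have e := lin (2 * q') (2 * q' + 2 * t') (by omega)
      have hn : ¬((2 * p' : ℤ) = 2 * q' ∧ (2 * p' + 2 * t' : ℤ) = 2 * q' + 2 * t') := by omega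
      rw [if_neg hn] at e
      simp at e
      omega
    subst hpq'
    -- The quadratic invariant is nonzero at this label, so the other circle must have loops of the
    -- same label.
    have e := quad (2 * p) (2 * p + 2 * t) (by omega)
    have pos := h.sum_sq_pos hp (by omega)
    by_cases hc : (2 * p' : ℤ) = 2 * p ∧ (2 * p' + 2 * t' : ℤ) = 2 * p + 2 * t
    · omega
    · simp only [if_neg hc, and_self, if_true] at e
      simp at e
      omega
  -- The value here is `p > 0`. On the other side only the case where just the first indicator is
  -- `1` is compatible with this.
  · have e := lin (2 * q) (2 * q + 2 * t) (by omega)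
    have hn : ¬((2 * p : ℤ) = 2 * q ∧ (2 * p + 2 * t : ℤ) = 2 * q + 2 * t) := by omega
    rw [if_neg hn, if_pos ⟨rfl, rfl⟩] at e
    split_ifs at e <;> omega

end Crossing

/-! ### Trivial induced 1-strings -/

theorem ext_arrows {n : ℕ} {β β' : VirtualString n} (h : β.arrows = β'.arrows) : β = β' := by
  cases β; cases β'; cases h; rfl

theorem not_btw_of_sbtw_of_btw {α : Type*} [CircularOrder α] {w x y z u : α} (h₁ : sbtw w x y)
    (h₂ : sbtw w y z) (hu : btw w u x) : ¬btw y u z := by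
  suffices h : sbtw z u y from h.not_btw
  by_cases hw : u = w
  · exact hw ▸ h₂.cyclic_right
  by_cases hx : u = x
  · exact hx ▸ (h₂.cyclic_left.trans_right h₁.cyclic_right).cyclic_left
  have hxw : x ≠ w := by rintro rfl; exact sbtw_irrefl_left h₁
  rcases sbtw_or_sbtw_of_ne (Ne.symm hw) hx hxw with h | h
  · exact (h₂.cyclic_left.trans_right (h.trans_right h₁).cyclic_right).cyclic_left
  · exact absurd hu h.not_btw

/-- The virtual string with only the arrows in a given set. -/
def restrict {n : ℕ} (β : VirtualString n) (A : Set (CorePoint n × CorePoint n)) :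
    VirtualString n where
  arrows := β.arrows ∩ A
  finite_arrows := β.finite_arrows.inter_of_left A
  tail_ne_head := fun g hg h hh => β.tail_ne_head g hg.1 h hh.1
  tail_injOn := β.tail_injOn.mono Set.inter_subset_left
  head_injOn := β.head_injOn.mono Set.inter_subset_left

theorem virtuallyHomotopic_trivial_of_parallel {n N : ℕ} {β : VirtualString n} {c : Fin n}
    {k k' : Fin 8} (hk : k' < k)
    (h : β.arrows = Set.range (parallelArrow c k k' : Fin N → _)) :
    VirtuallyHomotopic β (trivial n) := by
  -- Arrows are added in increasing order of index: the arc of the arrow `j` contains no endpoints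
  -- of arrows of smaller index, so each addition is a type 1 move.
  let S : ℕ → VirtualString n := fun j =>
    β.restrict {g | ∃ i : Fin N, (i : ℕ) < j ∧ g = parallelArrow c k k' i}
  have mem : ∀ j g, g ∈ (S j).arrows ↔ ∃ i : Fin N, (i : ℕ) < j ∧ g = parallelArrow c k k' i := by
    intro j g
    refine ⟨fun hg => hg.2, fun hg => ⟨?_, hg⟩⟩
    obtain ⟨i, -, rfl⟩ := hg
    rw [h]
    exact ⟨i, rfl⟩
  have step : ∀ j ≤ N, VirtuallyHomotopic (S j) (trivial n) := by
    intro j hj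
    induction j with
    | zero =>
      have : S 0 = trivial n := by
        apply ext_arrows
        ext g
        simp [mem, trivial]
      rw [this]
      exact Relation.EqvGen.refl _
    | succ j ih =>
      refine Relation.EqvGen.trans _ _ _ (Relation.EqvGen.symm _ _ (Relation.EqvGen.rel _ _
        (Or.inr ?_))) (ih (by omega))
      set i : Fin N := ⟨j, hj⟩
      have hne : ((c, clusterPoint k i) : CorePoint n) ≠ (c, clusterPoint k' i.rev) := fun e =>
        clusterPoint_ne hk.ne' _ _ (Prod.ext_iff.1 e).2
      have hc : ((c, clusterPoint k i) : CorePoint n).1 =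
          ((c, clusterPoint k' i.rev) : CorePoint n).1 := rfl
      refine Move.type1a _ _ (c, clusterPoint k i) (c, clusterPoint k' i.rev) rfl ?_ ?_
      · rw [Set.disjoint_right]
        rintro z (⟨g, hg, rfl⟩ | ⟨g, hg, rfl⟩) <;> obtain ⟨l, hl, rfl⟩ := (mem _ _).1 hg <;>
          rw [mem_arc_iff_arcWeight_ne_zero hc hne, not_not, parallelArrow]
        · rw [arcWeight_cluster_tail c hk]
          have hl' : l < i := hl
          simp [parallelWeight, hl'.ne, hl'.not_gt]
        · rw [arcWeight_cluster_head c hk]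
          have hl' : l < i := hl
          simp [parallelWeight, hl'.ne, hl'.not_gt]
      · ext g
        rw [Set.mem_insert_iff, mem, mem]
        constructor
        · rintro ⟨l, hl, rfl⟩
          rcases Nat.lt_succ_iff_lt_or_eq.1 hl with hl | hl
          · exact Or.inr ⟨l, hl, rfl⟩
          · left
            obtain rfl : l = i := Fin.ext hl
            rfl
        · rintro (rfl | ⟨l, hl, rfl⟩)
          · exact ⟨i, Nat.lt_succ_self j, rfl⟩
          · exact ⟨l, by omega, rfl⟩
  have : S N = β := by
    apply ext_arrows
    ext g
    rw [mem, h]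
    constructor
    · rintro ⟨i, -, rfl⟩; exact ⟨i, rfl⟩
    · rintro ⟨i, rfl⟩; exact ⟨i, i.2, rfl⟩
  exact this ▸ step N le_rfl

theorem virtuallyHomotopic_trivial_of_simple_crossing {n : ℕ} {β : VirtualString n} {c : Fin n}
    (h : β.arrows = Set.range (parallelArrow c 4 0 : Fin 1 → _) ∪
      Set.range (parallelArrow c 6 2 : Fin 1 → _)) :
    VirtuallyHomotopic β (trivial n) := by
  refine Relation.EqvGen.symm _ _ (Relation.EqvGen.rel _ _ (Or.inr ?_))
  have lt : ∀ {k k' : Fin 8}, k < k' →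
      clusterPosition k (0 : Fin 1) < clusterPosition k' (0 : Fin 1) :=
    fun hk => clusterPosition_lt_of_lt hk _ _
  have h₁ : sbtw (clusterPoint 2 (0 : Fin 1)) (clusterPoint 4 (0 : Fin 1))
      (clusterPoint 6 (0 : Fin 1)) := sbtw_clusterPoint (lt (by decide)) (lt (by decide))
  have h₂ : sbtw (clusterPoint 2 (0 : Fin 1)) (clusterPoint 6 (0 : Fin 1))
      (clusterPoint 0 (0 : Fin 1)) :=
    (sbtw_clusterPoint (lt (by decide)) (lt (by decide))).cyclic_left
  -- The free arcs run from the top to the left and from the bottom to the right. Each is traversed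
  -- from `a'` to `a`, respectively from `b'` to `b`.
  refine Move.type2 _ _ (c, clusterPoint 4 (0 : Fin 1)) (c, clusterPoint 2 (0 : Fin 1))
    (c, clusterPoint 0 (0 : Fin 1)) (c, clusterPoint 6 (0 : Fin 1))
    (c, clusterPoint 2 (0 : Fin 1)) (c, clusterPoint 4 (0 : Fin 1))
    (c, clusterPoint 6 (0 : Fin 1)) (c, clusterPoint 0 (0 : Fin 1))
    (Or.inr rfl) (Or.inr rfl) rfl rfl ?_ ?_ ?_ ?_
  · simp [endpoints, trivial]
  · simp [endpoints, trivial]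
  · rw [Set.disjoint_left]
    exact fun z hz hz' => not_btw_of_sbtw_of_btw h₁ h₂ hz.2 hz'.2
  · rw [h]
    ext g
    simp [parallelArrow, trivial, eq_comm]

section Component

variable (p₁ q₁ p₂ q₂ r s : ℕ)

theorem component_zero_arrows : ((betaString p₁ q₁ p₂ q₂ r s).component 0).arrows =
    Set.range (parallelArrow 0 4 0 : Fin p₁ → _) ∪
      Set.range (parallelArrow 0 6 2 : Fin q₁ → _) := by
  ext ⟨⟨i, x⟩, ⟨j, y⟩⟩
  obtain rfl := Subsingleton.elim i 0
  obtain rfl := Subsingleton.elim j 0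
  simp [component, betaString, onCircle, parallelArrow, betaTail, betaHead]

theorem component_one_arrows : ((betaString p₁ q₁ p₂ q₂ r s).component 1).arrows =
    Set.range (parallelArrow 0 4 0 : Fin p₂ → _) ∪
      Set.range (parallelArrow 0 6 2 : Fin q₂ → _) := by
  ext ⟨⟨i, x⟩, ⟨j, y⟩⟩
  obtain rfl := Subsingleton.elim i 0
  obtain rfl := Subsingleton.elim j 0
  simp [component, betaString, onCircle, parallelArrow, betaTail, betaHead]

end Component

theorem IsNontrivial.parameters {β : VirtualString 1} {p q : ℕ} (hβ : β.IsNontrivial)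
    (h : β.arrows = Set.range (parallelArrow 0 4 0 : Fin p → _) ∪
      Set.range (parallelArrow 0 6 2 : Fin q → _)) :
    0 < p ∧ 0 < q ∧ ¬(p = 1 ∧ q = 1) := by
  refine ⟨Nat.pos_of_ne_zero ?_, Nat.pos_of_ne_zero ?_, ?_⟩
  · rintro rfl
    refine hβ (virtuallyHomotopic_trivial_of_parallel (c := 0) (k := 6) (k' := 2) (N := q)
      (by decide) ?_)
    rw [h, Set.range_eq_empty, Set.empty_union]
  · rintro rfl
    refine hβ (virtuallyHomotopic_trivial_of_parallel (c := 0) (k := 4) (k' := 0) (N := p)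
      (by decide) ?_)
    rw [h, Set.range_eq_empty (parallelArrow 0 6 2 : Fin 0 → _), Set.union_empty]
  · rintro ⟨rfl, rfl⟩
    exact hβ (virtuallyHomotopic_trivial_of_simple_crossing h)

/-! ### Conclusion -/

theorem Same.refl {n : ℕ} (β : VirtualString n) : Same β β :=
  ⟨1, fun _ => Homeomorph.refl _, fun _ _ _ _ => Iff.rfl, by simp [Prod.map]⟩

theorem same_betaString_swap (p q p' q' : ℕ) :
    Same (betaString p q p' q' 0 0) (betaString p' q' p q 0 0) := by
  refine ⟨Equiv.swap 0 1, fun _ => Homeomorph.refl _, fun _ _ _ _ => Iff.rfl, ?_⟩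
  apply Set.Subset.antisymm
  · rintro _ ⟨(i | i) | (i | i) | (i | i), rfl⟩
    · exact ⟨_, ⟨.inr (.inl (.inl i)), rfl⟩, rfl⟩
    · exact ⟨_, ⟨.inr (.inl (.inr i)), rfl⟩, rfl⟩
    · exact ⟨_, ⟨.inl (.inl i), rfl⟩, rfl⟩
    · exact ⟨_, ⟨.inl (.inr i), rfl⟩, rfl⟩
    · exact i.elim0
    · exact i.elim0
  · rintro _ ⟨_, ⟨(i | i) | (i | i) | (i | i), rfl⟩, rfl⟩
    · exact ⟨.inr (.inl (.inl i)), rfl⟩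
    · exact ⟨.inr (.inl (.inr i)), rfl⟩
    · exact ⟨.inl (.inl i), rfl⟩
    · exact ⟨.inl (.inr i), rfl⟩
    · exact i.elim0
    · exact i.elim0

end VirtualString

open VirtualString

theorem proposition4p3 (p₁ q₁ p₂ q₂ r s p₁' q₁' p₂' q₂' r' s' : ℕ)
    (h₁ : ∀ i, ((betaString p₁ q₁ p₂ q₂ r s).component i).IsNontrivial)
    (h₂ : ∀ i, ((betaString p₁' q₁' p₂' q₂' r' s').component i).IsNontrivial) :
    (betaString p₁' q₁' p₂' q₂' r' s').VirtuallyHomotopic (betaString p₁ q₁ p₂ q₂ r s) ↔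
      (betaString p₁' q₁' p₂' q₂' r' s').Same (betaString p₁ q₁ p₂ q₂ r s) := by
  refine ⟨fun h => ?_, fun h => Relation.EqvGen.rel _ _ (Or.inl h)⟩
  obtain ⟨a₁, b₁, -⟩ := (h₁ 0).parameters (component_zero_arrows p₁ q₁ p₂ q₂ r s)
  obtain ⟨a₂, b₂, -⟩ := (h₁ 1).parameters (component_one_arrows p₁ q₁ p₂ q₂ r s)
  obtain ⟨a₁', b₁', d₁⟩ := (h₂ 0).parameters (component_zero_arrows p₁' q₁' p₂' q₂' r' s')
  obtain ⟨a₂', b₂', d₂⟩ := (h₂ 1).parameters (component_one_arrows p₁' q₁' p₂' q₂' r' s')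
  have x₀ := isCrossing_betaString_zero p₁ q₁ p₂ q₂ r s
  have x₁ := isCrossing_betaString_one p₁ q₁ p₂ q₂ r s
  have y₀ := isCrossing_betaString_zero p₁' q₁' p₂' q₂' r' s'
  have y₁ := isCrossing_betaString_one p₁' q₁' p₂' q₂' r' s'
  obtain ⟨σ, hσ⟩ := h.sameInvariants
  have s₀ := hσ 0
  have s₁ := hσ 1
  have perm_cases : ∀ ρ : Equiv.Perm (Fin 2), (ρ 0 = 0 ∧ ρ 1 = 1) ∨ (ρ 0 = 1 ∧ ρ 1 = 0) := by
    decide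
  rcases perm_cases σ with ⟨e₀, e₁⟩ | ⟨e₀, e₁⟩ <;> rw [e₀] at s₀ <;> rw [e₁] at s₁
  · obtain ⟨rfl, rfl, t₀, m₀⟩ := y₀.parameters_eq x₀ s₀ a₁' b₁' d₁ a₁ b₁
    obtain ⟨rfl, rfl, -, -⟩ := y₁.parameters_eq x₁ s₁ a₂' b₂' d₂ a₂ b₂
    -- On the first circle `t` is `-s` and the circle index is `r - s`, which together give both
    -- parameters.
    obtain rfl : s' = s := by omega
    obtain rfl : r' = r := by omega
    exact Same.refl _
  · obtain ⟨rfl, rfl, t₀, m₀⟩ := y₀.parameters_eq x₁ s₀ a₁' b₁' d₁ a₂ b₂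
    obtain ⟨rfl, rfl, -, -⟩ := y₁.parameters_eq x₀ s₁ a₂' b₂' d₂ a₁ b₁
    -- With the circles exchanged, the equations read `-s' = s` and `r' - s' = s - r`. All four
    -- numbers are nonnegative, so all vanish.
    obtain rfl : s = 0 := by omega
    obtain rfl : s' = 0 := by omega
    obtain rfl : r = 0 := by omega
    obtain rfl : r' = 0 := by omega
    exact same_betaString_swap _ _ _ _
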